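/- Let $\ell$ be a prime number and let $C$ be an algebraic closure of $\mathbb{Q}_\ell$, with the topology defined by the $\ell$-adic valuation. An \emph{admissible $\ell$-adic subring} of $C$ is a subring $\Lambda_0\subset C$ which, for the subspace topology, is isomorphic as a topological ring to a finite extension of $\mathbb{Q}_\ell$, to the ring of integers of such an extension, or to a discrete finite local $\mathbb{Z}/\ell^n$-algebra for some $n$ (the last case does not occur in $C$). A map from a topological space to $C^\times$ (resp. to $\mathrm{Aut}_C(V)$, where $V$ is a finite-dimensional $C$-vector space) is \emph{$C$-admissible} if it is continuous and factors through $\Lambda_0^\times$ (resp. through $\mathrm{Aut}_{\Lambda_0}(V_0)$ for some $\Lambda_0$-form $V_0$ of $V$) for some admissible $\ell$-adic subring $\Lambda_0$ of $C$. A \emph{$C$-twisted topological group} is a pair $(G,\mu)$, where $G$ is a topological group and $\mu : G\times G\to C^\times$ is a $C$-admissible map such that $\mu(1,1)=1$ and $\mu(x,y)\mu(xy,z)=\mu(x,yz)\mu(y,z)$ for all $x,y,z\in G$. A \emph{$C$-admissible representation} of $(G,\mu)$ is a finite-dimensional $C$-vector space $V$ with a $C$-admissible map $\rho : G\to\mathrm{Aut}_C(V)$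 such that $\rho(x)\rho(y)=\mu(x,y)\rho(xy)$ for all $x,y\in G$; it has \emph{finite projective image} if the image of $G$ in $\mathrm{Aut}_C(V)/C^\times$ is finite. Let $K_0^{\mathrm{fin}}(G,\mu,C)$ be the Grothendieck group of $C$-admissible representations of $(G,\mu)$ with finite projective image: the abelian group generated by the classes $[V]$ of such representations (with underlying space $C^n$ for some $n\ge 0$), subject to the relations $[V]=[V']+[V'']$ for every exact sequence $0\to V'\to V\to V''\to 0$ of such representations. The class $[V]$ of a representation with finite projective image on an arbitrary finite-dimensional space is that of any isomorphic representation on some $C^n$. Let $C[G,\mu]$ be the twisted group algebra, with $C$-basis $([x])_{x\in G}$ and product $[x][y]=\mu(x,y)[xy]$. For an open subgroup $H$ of finite index in $G$ and a $C$-admissible representation $V$ of $(H,\mu_{|H})$, put $\mathrm{Ind}_H^G V=C[G,\mu]\otimes_{C[H,\mu_{|H}]}V$, on which $x \in G$ acts by left multiplication by $[x]$. \textbf{Theorem.} Let $(G,\mu)$ be a $C$-twisted topological group. Then the abelian group $K_0^{\mathrm{fin}}(G,\mu,C)$ is generated by the classes of those $C$-admissible representations of $(G,\mu)$ with finite projective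 image which are isomorphic to $\mathrm{Ind}_H^G V$ for some open subgroup $H$ of finite index in $G$ and some one-dimensional $C$-admissible representation $V$ of $(H,\mu_{|H})$. -/

import Mathlib

namespace TwistedBrauer

/-! ### Admissible `ℓ`-adic rings

Throughout, `C = PadicAlgCl ℓ` is the algebraic closure of `ℚ_[ℓ]`, with the topology of the
unique extension of the `ℓ`-adic absolute value. -/

/-- The ring of integers of a subextension `E` of `C / ℚ_[ℓ]`, as a subring of `C`. -/
noncomputable def ringOfIntegers (ℓ : ℕ) [Fact ℓ.Prime]
    (E : IntermediateField ℚ_[ℓ] (PadicAlgCl ℓ)) : Subring (PadicAlgCl ℓ) :=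
  E.toSubring ⊓ (integralClosure ℤ_[ℓ] (PadicAlgCl ℓ)).toSubring

/-- Isomorphism of topological rings. -/
def TopRingIso (R S : Type*) [CommRing R] [TopologicalSpace R] [CommRing S]
    [TopologicalSpace S] : Prop :=
  ∃ e : R ≃+* S, IsHomeomorph e

/-- An admissible `ℓ`-adic ring is a topological ring isomorphic to a finite local
`ℤ/ℓⁿ`-algebra with the discrete topology, to the ring of integers of a finite extension of
`ℚ_[ℓ]`, or to a finite extension of `ℚ_[ℓ]`, with the `ℓ`-adic topology. (Every finite extension
of `ℚ_[ℓ]` is isomorphic to a subextension of `C`, which carries the subspace topology.) -/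
def IsAdmissibleRing (ℓ : ℕ) [Fact ℓ.Prime] (R : Type*) [CommRing R] [TopologicalSpace R] :
    Prop :=
  (DiscreteTopology R ∧ Finite R ∧ IsLocalRing R ∧ ∃ n : ℕ, (ℓ : R) ^ n = 0) ∨
  (∃ E : IntermediateField ℚ_[ℓ] (PadicAlgCl ℓ), FiniteDimensional ℚ_[ℓ] E ∧
    TopRingIso R (ringOfIntegers ℓ E)) ∨
  (∃ E : IntermediateField ℚ_[ℓ] (PadicAlgCl ℓ), FiniteDimensional ℚ_[ℓ] E ∧
    TopRingIso R E.toSubring)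

/-- A map to `Cˣ` is `C`-admissible if it is continuous and factors through `Λ₀ˣ` for some
subring `Λ₀` of `C` that is an admissible `ℓ`-adic ring for the subspace topology. -/
def IsAdmissibleUnitsMap {ℓ : ℕ} [Fact ℓ.Prime] {T : Type*} [TopologicalSpace T]
    (f : T → (PadicAlgCl ℓ)ˣ) : Prop :=
  Continuous f ∧ ∃ Λ₀ : Subring (PadicAlgCl ℓ), IsAdmissibleRing ℓ Λ₀ ∧
    ∀ t, (f t : PadicAlgCl ℓ) ∈ Λ₀ ∧ (((f t)⁻¹ : (PadicAlgCl ℓ)ˣ) : PadicAlgCl ℓ) ∈ Λ₀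

/-- A map to `Aut_C(V)`, `V` a finite-dimensional `C`-vector space, is `C`-admissible if it is
continuous and factors through `Aut_{Λ₀}(V₀)` for some `Λ₀`-form `V₀` of `V`, where `Λ₀` is an
admissible `ℓ`-adic subring of `C`. The form `V₀` is the `Λ₀`-span of a basis `b` of `V`; the
topology of `Aut_C(V)` is that of `GL_n(C)`, so that continuity means continuity of the matrix
(in one or any basis), inversion being continuous on `GL_n(C)`. -/
def IsAdmissibleAutMap {ℓ : ℕ} [Fact ℓ.Prime] {T : Type*} [TopologicalSpace T]
    {V : Type*} [AddCommGroup V] [Module (PadicAlgCl ℓ) V]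
    (f : T → (V ≃ₗ[PadicAlgCl ℓ] V)) : Prop :=
  ∃ (n : ℕ) (b : Module.Basis (Fin n) (PadicAlgCl ℓ) V) (Λ₀ : Subring (PadicAlgCl ℓ)),
    IsAdmissibleRing ℓ Λ₀ ∧
    Continuous (fun t => LinearMap.toMatrix b b (f t).toLinearMap) ∧
    ∀ t i j, LinearMap.toMatrix b b (f t).toLinearMap i j ∈ Λ₀ ∧
      LinearMap.toMatrix b b (f t).symm.toLinearMap i j ∈ Λ₀

/-! ### Twisted groups and their representations -/

/-- A `C`-admissible multiplier on `G`: a normalized admissible `2`-cocycle with values in `Cˣ`.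
A `C`-twisted topological group is a topological group with such a multiplier. -/
structure Multiplier (ℓ : ℕ) [Fact ℓ.Prime] (G : Type*) [Group G] [TopologicalSpace G] where
  toFun : G → G → (PadicAlgCl ℓ)ˣ
  admissible : IsAdmissibleUnitsMap (fun p : G × G => toFun p.1 p.2)
  cocycle : ∀ x y z, toFun x y * toFun (x * y) z = toFun x (y * z) * toFun y z
  one_one : toFun 1 1 = 1

variable {ℓ : ℕ} [Fact ℓ.Prime] {G : Type*} [Group G] [TopologicalSpace G]

/-- The restriction of a multiplier to a subgroup. -/
def Multiplier.restrict (μ : Multiplier ℓ G) (H : Subgroup G) : Multiplier ℓ H where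
  toFun x y := μ.toFun x y
  admissible := by
    obtain ⟨hc, Λ₀, h₀, h⟩ := μ.admissible
    exact ⟨hc.comp (f := fun p : H × H => ((p.1 : G), (p.2 : G))) (by fun_prop), Λ₀, h₀,
      fun p => h (p.1, p.2)⟩
  cocycle x y z := μ.cocycle x y z
  one_one := μ.one_one

/-- A `C`-admissible representation of `(G, μ)` on `V` (finite-dimensional, since admissibility
provides a finite basis). -/
structure AdmissibleRep (μ : Multiplier ℓ G) (V : Type*) [AddCommGroup V]
    [Module (PadicAlgCl ℓ) V] where
  ρ : G → (V ≃ₗ[PadicAlgCl ℓ] V)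
  admissible : IsAdmissibleAutMap ρ
  twisted : ∀ x y v, ρ x (ρ y v) = (μ.toFun x y : PadicAlgCl ℓ) • ρ (x * y) v

/-- The subgroup `Cˣ` of homotheties in `Aut_C(V)`. -/
noncomputable def homotheties (ℓ : ℕ) [Fact ℓ.Prime] (V : Type*) [AddCommGroup V] [Module (PadicAlgCl ℓ) V] :
    Subgroup (V ≃ₗ[PadicAlgCl ℓ] V) :=
  (DistribMulAction.toModuleAut (PadicAlgCl ℓ) V (S := (PadicAlgCl ℓ)ˣ)).range

/-- The image of `G` in `Aut_C(V) / Cˣ` is finite. -/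
def AdmissibleRep.HasFiniteProjectiveImage {μ : Multiplier ℓ G} {V : Type*} [AddCommGroup V]
    [Module (PadicAlgCl ℓ) V] (r : AdmissibleRep μ V) : Prop :=
  (Set.range (fun g : G =>
    (QuotientGroup.mk (r.ρ g) : (V ≃ₗ[PadicAlgCl ℓ] V) ⧸ homotheties ℓ V))).Finite

/-! ### Induction

For a subgroup `H` and a representation `V` of `(H, μ|_H)`, the induced representation
`C[G,μ] ⊗_{C[H,μ|H]} V` is the quotient of `C[G,μ] ⊗_C V = (G →₀ V)`, in which `[g] ⊗ v` is
`single g v`, by the relations `[g][h] ⊗ v = [g] ⊗ ρ(h) v`, where `[g][h] = μ(g,h) [gh]`. -/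

/-- The span of the elements `[g][h] ⊗ v - [g] ⊗ ρ(h) v`. -/
noncomputable def indRelations (μ : Multiplier ℓ G) (H : Subgroup G) {V : Type*}
    [AddCommGroup V] [Module (PadicAlgCl ℓ) V] (r : AdmissibleRep (μ.restrict H) V) :
    Submodule (PadicAlgCl ℓ) (G →₀ V) :=
  Submodule.span (PadicAlgCl ℓ)
    {w | ∃ (g : G) (h : H) (v : V),
      w = (μ.toFun g h : PadicAlgCl ℓ) • Finsupp.single (g * h) v - Finsupp.single g (r.ρ h v)}

/-- The underlying vector space of `Ind_H^G V`. -/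
abbrev Ind (μ : Multiplier ℓ G) (H : Subgroup G) {V : Type*}
    [AddCommGroup V] [Module (PadicAlgCl ℓ) V] (r : AdmissibleRep (μ.restrict H) V) : Type _ :=
  (G →₀ V) ⧸ indRelations μ H r

/-- Left multiplication by `[x]` on `C[G,μ] ⊗_C V`: `[x] ([g] ⊗ v) = μ(x,g) [xg] ⊗ v`. -/
noncomputable def leftMul (μ : Multiplier ℓ G) (V : Type*) [AddCommGroup V]
    [Module (PadicAlgCl ℓ) V] (x : G) : (G →₀ V) →ₗ[PadicAlgCl ℓ] (G →₀ V) :=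
  Finsupp.lsum (PadicAlgCl ℓ) fun g =>
    (μ.toFun x g : PadicAlgCl ℓ) • Finsupp.lsingle (R := PadicAlgCl ℓ) (M := V) (x * g)

theorem leftMul_single (μ : Multiplier ℓ G) (V : Type*) [AddCommGroup V]
    [Module (PadicAlgCl ℓ) V] (x g : G) (v : V) :
    leftMul μ V x (Finsupp.single g v)
      = (μ.toFun x g : PadicAlgCl ℓ) • Finsupp.single (x * g) v := by
  simp [leftMul]

theorem indRelations_le_comap (μ : Multiplier ℓ G) (H : Subgroup G) {V : Type*}
    [AddCommGroup V] [Module (PadicAlgCl ℓ) V] (r : AdmissibleRep (μ.restrict H) V) (x : G) :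
    indRelations μ H r ≤ (indRelations μ H r).comap (leftMul μ V x) := by
  refine Submodule.span_le.2 ?_
  rintro _ ⟨g, h, v, rfl⟩
  have key : leftMul μ V x ((μ.toFun g h : PadicAlgCl ℓ) • Finsupp.single (g * h) v
        - Finsupp.single g (r.ρ h v))
      = (μ.toFun x g : PadicAlgCl ℓ) •
        ((μ.toFun (x * g) h : PadicAlgCl ℓ) • Finsupp.single (x * g * h) v
          - Finsupp.single (x * g) (r.ρ h v)) := by
    have hc := congrArg (Units.val) (μ.cocycle x g h)
    simp only [Units.val_mul] at hc
    rw [map_sub, map_smul, leftMul_single, leftMul_single, smul_sub, smul_smul, smul_smul, hc,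
      mul_assoc x g h, mul_comm]
  change leftMul μ V x _ ∈ indRelations μ H r
  rw [key]
  exact Submodule.smul_mem _ _ (Submodule.subset_span ⟨x * g, h, v, rfl⟩)

/-- The action of `x : G` on `Ind_H^G V`. -/
noncomputable def indAct (μ : Multiplier ℓ G) (H : Subgroup G) {V : Type*}
    [AddCommGroup V] [Module (PadicAlgCl ℓ) V] (r : AdmissibleRep (μ.restrict H) V) (x : G) :
    Ind μ H r →ₗ[PadicAlgCl ℓ] Ind μ H r :=
  Submodule.mapQ _ _ (leftMul μ V x) (indRelations_le_comap μ H r x)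

/-! ### The Grothendieck group -/

/-- `C`-admissible representations of `(G, μ)` with finite projective image, on some `Cⁿ`. -/
structure FinRep (μ : Multiplier ℓ G) where
  n : ℕ
  rep : AdmissibleRep μ (Fin n → PadicAlgCl ℓ)
  fin : rep.HasFiniteProjectiveImage

/-- There is a short exact sequence `0 → V' → V → V'' → 0` of representations of `(G, μ)`. -/
def FinRep.IsExtension {μ : Multiplier ℓ G} (V' V V'' : FinRep μ) : Prop :=
  ∃ (i : (Fin V'.n → PadicAlgCl ℓ) →ₗ[PadicAlgCl ℓ] (Fin V.n → PadicAlgCl ℓ))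
    (p : (Fin V.n → PadicAlgCl ℓ) →ₗ[PadicAlgCl ℓ] (Fin V''.n → PadicAlgCl ℓ)),
    Function.Injective i ∧ Function.Surjective p ∧ LinearMap.range i = LinearMap.ker p ∧
    (∀ g v, i (V'.rep.ρ g v) = V.rep.ρ g (i v)) ∧
    (∀ g v, p (V.rep.ρ g v) = V''.rep.ρ g (p v))

/-- The subgroup generated by the relations `[V'] + [V''] - [V]`. -/
def K0finRelations (μ : Multiplier ℓ G) : AddSubgroup (FreeAbelianGroup (FinRep μ)) :=
  AddSubgroup.closure {x | ∃ V' V V'' : FinRep μ, FinRep.IsExtension V' V V'' ∧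
    x = FreeAbelianGroup.of V' + FreeAbelianGroup.of V'' - FreeAbelianGroup.of V}

/-- The Grothendieck group `K₀^fin(G, μ, C)`. -/
abbrev K0fin (μ : Multiplier ℓ G) : Type _ :=
  FreeAbelianGroup (FinRep μ) ⧸ K0finRelations μ

/-- The class `[V]` in `K₀^fin(G, μ, C)`. -/
def FinRep.cls {μ : Multiplier ℓ G} (V : FinRep μ) : K0fin μ :=
  QuotientAddGroup.mk (FreeAbelianGroup.of V)

/-- `W` is isomorphic to `Ind_H^G V` as a representation of `(G, μ)`. -/
def FinRep.IsoInd {μ : Multiplier ℓ G} (W : FinRep μ) (H : Subgroup G) {V : Type*}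
    [AddCommGroup V] [Module (PadicAlgCl ℓ) V] (r : AdmissibleRep (μ.restrict H) V) : Prop :=
  ∃ e : (Fin W.n → PadicAlgCl ℓ) ≃ₗ[PadicAlgCl ℓ] Ind μ H r,
    ∀ g w, e (W.rep.ρ g w) = indAct μ H r g (e w)

/-- `W` is of the form `Ind_H^G V` with `H` an open subgroup of finite index and `V` a
one-dimensional `C`-admissible representation of `(H, μ|_H)`. -/
def FinRep.IsInducedFromRankOne {μ : Multiplier ℓ G} (W : FinRep μ) : Prop :=
  ∃ H : Subgroup G, IsOpen (H : Set G) ∧ H.FiniteIndex ∧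
    ∃ (V : Type) (_ : AddCommGroup V) (_ : Module (PadicAlgCl ℓ) V)
      (r : AdmissibleRep (μ.restrict H) V),
      Module.finrank (PadicAlgCl ℓ) V = 1 ∧ W.IsoInd H r

end TwistedBrauer

/-! Let `W` have finite projective image, and let `N` be the subgroup of `G` acting on `W` by
scalars; it is normal, open and of finite index. If `M` is a linear representation of the finite
group `Q = G ⧸ N`, then `W ⊗ M` has the same multiplier as `W` and its class is additive in `M`.
That class therefore depends only on the character of `M` (`eq_of_character_eq`), so identities
between characters of `Q` become identities in `K0fin μ`.

The identity used is Solomon's (`isQuasiElementaryMark_one`): 1 = |X^g| - |Y^g| for two finite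
`Q`-sets with quasi-elementary stabilizers. It yields [W] = [W ⊗ C^X] - [W ⊗ C^Y]. Now W ⊗ C^X is
the direct sum of the blocks W ⊗ e_x, which `G` permutes, and the stabilizer of `x` acts on its
block, up to scalars, through a quasi-elementary group. Such an action is monomial
(`IsProjRep.isMonomialOn_of_isQuasiElementary`): cut the space into eigenspaces of an element
generating a nontrivial cyclic normal subgroup modulo scalars, and induct on the dimension. Hence
`G` permutes the lines of a basis of W ⊗ C^X. Each orbit of lines spans a representation induced
from the stabilizer of one line, and this stabilizer is open because it is closed of finite index.

Admissible rings are given only up to abstract topological isomorphism.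
`IsAdmissibleRing.exists_finiteDimensional` reduces admissibility to continuity together with values
in a finite extension of ℚ_ℓ, a condition visibly stable under the operations above. -/

namespace TwistedBrauer

open scoped TensorProduct

universe u v

/-! ### Quasi-elementary subgroups -/

/-- A subgroup is quasi-elementary if it has a cyclic normal subgroup whose quotient is a
`p`-group for some prime `p`. -/
def IsQuasiElementary {Q : Type*} [Group Q] (H : Subgroup Q) : Prop :=
  ∃ p : ℕ, p.Prime ∧ ∃ c ∈ H, (∀ x ∈ H, x * c * x⁻¹ ∈ Subgroup.zpowers c) ∧
    ∀ x ∈ H, ∃ n : ℕ, x ^ p ^ n ∈ Subgroup.zpowers c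

theorem conj_mem_zpowers {Q : Type*} [Group Q] {x c y : Q}
    (h : x * c * x⁻¹ ∈ Subgroup.zpowers c) (hy : y ∈ Subgroup.zpowers c) :
    x * y * x⁻¹ ∈ Subgroup.zpowers c := by
  obtain ⟨n, rfl⟩ := Subgroup.mem_zpowers_iff.1 hy
  rw [← conj_zpow]
  exact Subgroup.zpow_mem _ h n

/-- The new cyclic subgroup is `K ⊓ zpowers c`, cyclic inside `zpowers c`; the `p`-power condition
passes to it because powers of elements of `K` stay in `K`. -/
theorem IsQuasiElementary.mono {Q : Type*} [Group Q] {H K : Subgroup Q}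
    (hH : IsQuasiElementary H) (hK : K ≤ H) : IsQuasiElementary K := by
  obtain ⟨p, hp, c, -, hn, ht⟩ := hH
  obtain ⟨d, hd⟩ : ∃ d, Subgroup.zpowers d = K ⊓ Subgroup.zpowers c := by
    have : IsCyclic ↥(K ⊓ Subgroup.zpowers c) :=
      isCyclic_of_injective (Subgroup.inclusion (inf_le_right : K ⊓ Subgroup.zpowers c ≤ _))
        (Subgroup.inclusion_injective _)
    exact (Subgroup.isCyclic_iff_exists_zpowers_eq_top _).1 this
  have hdm : d ∈ K ⊓ Subgroup.zpowers c := hd ▸ Subgroup.mem_zpowers d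
  refine ⟨p, hp, d, hdm.1, fun x hx => ?_, fun x hx => ?_⟩
  · rw [hd]
    exact ⟨K.mul_mem (K.mul_mem hx hdm.1) (K.inv_mem hx), conj_mem_zpowers (hn x (hK hx)) hdm.2⟩
  · obtain ⟨n, h⟩ := ht x (hK hx)
    exact ⟨n, hd ▸ ⟨K.pow_mem hx _, h⟩⟩

theorem IsQuasiElementary.map {Q R : Type*} [Group Q] [Group R] {H : Subgroup Q}
    (hH : IsQuasiElementary H) (f : Q →* R) : IsQuasiElementary (H.map f) := by
  obtain ⟨p, hp, c, hc, hn, ht⟩ := hH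
  refine ⟨p, hp, f c, ⟨c, hc, rfl⟩, ?_, ?_⟩
  · rintro _ ⟨x, hx, rfl⟩
    rw [← MonoidHom.map_zpowers]
    exact ⟨_, hn x hx, by simp⟩
  · rintro _ ⟨x, hx, rfl⟩
    obtain ⟨n, h⟩ := ht x hx
    rw [← MonoidHom.map_zpowers]
    exact ⟨n, _, h, by simp⟩

/-- If `B` is a proper normal subgroup of a quasi-elementary group `H`, then `H / B` has a
nontrivial cyclic normal subgroup. -/
theorem IsQuasiElementary.exists_normal_cyclic {Q : Type*} [Group Q] [Finite Q] {H B : Subgroup Q}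
    (hH : IsQuasiElementary H) (hB : B < H) (hBn : ∀ x ∈ H, ∀ b ∈ B, x * b * x⁻¹ ∈ B) :
    ∃ a ∈ H, a ∉ B ∧ ∀ x ∈ H, ∃ k : ℤ, ∃ b ∈ B, x * a * x⁻¹ = a ^ k * b := by
  obtain ⟨p, hp, c, hc, hn, ht⟩ := hH
  -- If `B` contains `c`, then `H / B` is a nontrivial `p`-group and a nontrivial central element
  -- does the job with `k = 1`. Otherwise `c` itself does, with `b = 1`.
  by_cases hcB : c ∈ B
  · have hN : (B.subgroupOf H).Normal :=
      ⟨fun b hb x => hBn x x.2 b hb⟩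
    have hP : IsPGroup p (H ⧸ B.subgroupOf H) := by
      intro x
      induction x using QuotientGroup.induction_on with
      | H x =>
        obtain ⟨n, h⟩ := ht x x.2
        refine ⟨n, ?_⟩
        rw [← QuotientGroup.mk_pow, QuotientGroup.eq_one_iff, Subgroup.mem_subgroupOf]
        exact (Subgroup.zpowers_le.2 hcB) h
    have : Fact p.Prime := ⟨hp⟩
    have : Nontrivial (H ⧸ B.subgroupOf H) := by
      obtain ⟨-, x, hx, hxB⟩ := SetLike.lt_iff_le_and_exists.1 hB
      refine ⟨⟨(⟨x, hx⟩ : H), 1, fun h => hxB ?_⟩⟩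
      rwa [QuotientGroup.eq_one_iff] at h
    have := hP.center_nontrivial
    obtain ⟨⟨z, hz⟩, hz1⟩ := exists_ne (1 : Subgroup.center (H ⧸ B.subgroupOf H))
    obtain ⟨a, rfl⟩ := QuotientGroup.mk_surjective z
    refine ⟨a, a.2, fun h => hz1 ?_, fun x hx => ⟨1, a⁻¹ * (x * a * x⁻¹), ?_, by simp [mul_assoc]⟩⟩
    · ext
      exact (QuotientGroup.eq_one_iff _).2 h
    · have h := Subgroup.mem_center_iff.1 hz (QuotientGroup.mk (⟨x⁻¹, H.inv_mem hx⟩ : H))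
      rw [← QuotientGroup.mk_mul, ← QuotientGroup.mk_mul, QuotientGroup.eq] at h
      convert Subgroup.mem_subgroupOf.1 h using 1
      simp [mul_assoc]
  · refine ⟨c, hc, hcB, fun x hx => ?_⟩
    obtain ⟨k, hk⟩ := Subgroup.mem_zpowers_iff.1 (hn x hx)
    exact ⟨k, 1, B.one_mem, by rw [hk, mul_one]⟩

/-! ### Marks of finite sets and Solomon's induction theorem -/

/-- The functions `g ↦ |X^g| - |Y^g|` for finite `Q`-sets `X` and `Y` with quasi-elementary
stabilizers. -/
def IsQuasiElementaryMark {Q : Type u} [Group Q] (f : Q → ℤ) : Prop :=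
  ∃ (X Y : Type u) (_ : MulAction Q X) (_ : MulAction Q Y), Finite X ∧ Finite Y ∧
    (∀ x : X, IsQuasiElementary (MulAction.stabilizer Q x)) ∧
    (∀ y : Y, IsQuasiElementary (MulAction.stabilizer Q y)) ∧
    ∀ g, f g = (Nat.card (MulAction.fixedBy X g) : ℤ) - Nat.card (MulAction.fixedBy Y g)

namespace IsQuasiElementaryMark

variable {Q : Type u} [Group Q] {f f' : Q → ℤ}

theorem neg (h : IsQuasiElementaryMark f) : IsQuasiElementaryMark (-f) := by
  obtain ⟨X, Y, _, _, hX, hY, sX, sY, hf⟩ := h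
  exact ⟨Y, X, _, _, hY, hX, sY, sX, fun g => by simp [hf]⟩

theorem of_isQuasiElementary_stabilizer {X : Type u} [MulAction Q X] [Finite X]
    (sX : ∀ x : X, IsQuasiElementary (MulAction.stabilizer Q x)) :
    IsQuasiElementaryMark (fun g : Q => (Nat.card (MulAction.fixedBy X g) : ℤ)) :=
  ⟨X, PEmpty, inferInstance,
    { smul := fun _ x => x, one_smul := fun x => x.elim, mul_smul := fun _ _ x => x.elim },
    inferInstance, inferInstance, sX, fun x => x.elim, fun g => by simp⟩

theorem zero : IsQuasiElementaryMark (0 : Q → ℤ) := by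
  let _ : MulAction Q PEmpty.{u + 1} :=
    { smul := fun _ x => x, one_smul := fun x => x.elim, mul_smul := fun _ _ x => x.elim }
  convert of_isQuasiElementary_stabilizer (Q := Q) (X := PEmpty.{u + 1}) fun x => x.elim
  simp

/-- The action on a disjoint union. -/
abbrev sumAction (Q : Type*) [Group Q] (X Y : Type*) [MulAction Q X] [MulAction Q Y] :
    MulAction Q (X ⊕ Y) where
  smul g := Sum.map (g • ·) (g • ·)
  one_smul := by rintro (x | x) <;> simp [HSMul.hSMul]  <;> exact one_smul Q x
  mul_smul g h := by rintro (x | x) <;> simp [HSMul.hSMul] <;> exact mul_smul g h x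

attribute [local instance] sumAction

theorem card_fixedBy_sum (X Y : Type*) [MulAction Q X] [MulAction Q Y] [Finite X] [Finite Y]
    (g : Q) : Nat.card (MulAction.fixedBy (X ⊕ Y) g)
      = Nat.card (MulAction.fixedBy X g) + Nat.card (MulAction.fixedBy Y g) := by
  rw [← Nat.card_sum]
  refine Nat.card_congr ((Equiv.subtypeSum).trans (Equiv.sumCongr ?_ ?_))
  · exact Equiv.subtypeEquivRight fun x => Sum.inl_injective.eq_iff
  · exact Equiv.subtypeEquivRight fun x => Sum.inr_injective.eq_iff

theorem card_fixedBy_prod (X Y : Type*) [MulAction Q X] [MulAction Q Y] 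
    (g : Q) : Nat.card (MulAction.fixedBy (X × Y) g)
      = Nat.card (MulAction.fixedBy X g) * Nat.card (MulAction.fixedBy Y g) := by
  rw [← Nat.card_prod]
  refine Nat.card_congr ((Equiv.subtypeEquivRight fun x => ?_).trans (Equiv.subtypeProdEquivProd))
  exact Prod.ext_iff

theorem stabilizer_sum {X Y : Type*} [MulAction Q X] [MulAction Q Y]
    (sX : ∀ x : X, IsQuasiElementary (MulAction.stabilizer Q x))
    (sY : ∀ y : Y, IsQuasiElementary (MulAction.stabilizer Q y)) (z : X ⊕ Y) :
    IsQuasiElementary (MulAction.stabilizer Q z) := by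
  rcases z with x | y
  · exact (sX x).mono fun g hg => Sum.inl_injective hg
  · exact (sY y).mono fun g hg => Sum.inr_injective hg

theorem stabilizer_prod {X Y : Type*} [MulAction Q X] [MulAction Q Y]
    (sX : ∀ x : X, IsQuasiElementary (MulAction.stabilizer Q x)) (z : X × Y) :
    IsQuasiElementary (MulAction.stabilizer Q z) :=
  (sX z.1).mono fun _ hg => congrArg Prod.fst hg

theorem add (h : IsQuasiElementaryMark f) (h' : IsQuasiElementaryMark f') :
    IsQuasiElementaryMark (f + f') := by
  obtain ⟨X, Y, _, _, hX, hY, sX, sY, hf⟩ := h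
  obtain ⟨X', Y', _, _, hX', hY', sX', sY', hf'⟩ := h'
  refine ⟨X ⊕ X', Y ⊕ Y', inferInstance, inferInstance, inferInstance, inferInstance,
    stabilizer_sum sX sX', stabilizer_sum sY sY', fun g => ?_⟩
  rw [card_fixedBy_sum, card_fixedBy_sum, Pi.add_apply, hf, hf']
  push_cast
  ring

/-- Expand (X - Y)(X' - Y'). Stabilizers in a product are subgroups of stabilizers in a factor,
hence still quasi-elementary. With `add` and `neg`, the marks form a ring, possibly without unit;
Solomon's theorem says that the unit belongs to it. -/
theorem mul (h : IsQuasiElementaryMark f) (h' : IsQuasiElementaryMark f') :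
    IsQuasiElementaryMark (f * f') := by
  obtain ⟨X, Y, _, _, hX, hY, sX, sY, hf⟩ := h
  obtain ⟨X', Y', _, _, hX', hY', sX', sY', hf'⟩ := h'
  refine ⟨X × X' ⊕ Y × Y', X × Y' ⊕ Y × X', inferInstance, inferInstance, inferInstance,
    inferInstance, stabilizer_sum (stabilizer_prod sX) (stabilizer_prod sY),
    stabilizer_sum (stabilizer_prod sX) (stabilizer_prod sY), fun g => ?_⟩
  simp only [card_fixedBy_sum, card_fixedBy_prod, Pi.mul_apply, hf, hf']
  push_cast
  ring

end IsQuasiElementaryMark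

/-- For every `g` in a finite group and every prime `p` there is a quasi-elementary subgroup `H`
such that the number of fixed points of `g` on `Q / H` is prime to `p`. -/
theorem exists_isQuasiElementary_not_dvd_card_fixedBy {Q : Type*} [Group Q] [Finite Q] (g : Q)
    {p : ℕ} (hp : p.Prime) : ∃ H : Subgroup Q, IsQuasiElementary H ∧
      ¬ p ∣ Nat.card (MulAction.fixedBy (Q ⧸ H) g) := by
  have : Fact p.Prime := ⟨hp⟩
  -- The element `c = g ^ p ^ a` generates the part of `zpowers g` of order prime to `p`. The
  -- subgroup sought is `zpowers c` times a Sylow `p`-subgroup of its normalizer `N`.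
  obtain ⟨a, m, hm, hgm⟩ := Nat.exists_eq_pow_mul_and_not_dvd (orderOf_pos g).ne' p hp.ne_one
  set c := g ^ p ^ a with hc
  have hco : orderOf c = m := by
    rw [hc, orderOf_pow_of_dvd (pow_pos hp.pos a).ne' (hgm ▸ dvd_mul_right _ _), hgm,
      Nat.mul_div_cancel_left _ (pow_pos hp.pos a)]
  set N := Subgroup.normalizer (Subgroup.zpowers c : Set Q) with hN
  have hcN : Subgroup.zpowers c ≤ N := Subgroup.le_normalizer
  let K := (Subgroup.zpowers c).subgroupOf N
  have hKn : K.Normal := Subgroup.normal_in_normalizer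
  obtain ⟨P⟩ : Nonempty (Sylow p N) := inferInstance
  let H' : Subgroup N := K ⊔ P
  let H : Subgroup Q := H'.map N.subtype
  have hcH : c ∈ H := ⟨⟨c, hcN (Subgroup.mem_zpowers c)⟩,
    (le_sup_left : K ≤ H') (Subgroup.mem_subgroupOf.2 (Subgroup.mem_zpowers c)), rfl⟩
  have hHt : ∀ x ∈ H, ∃ n : ℕ, x ^ p ^ n ∈ Subgroup.zpowers c := by
    rintro _ ⟨x, hx, rfl⟩
    have hx' : (QuotientGroup.mk' K) x ∈ (P : Subgroup N).map (QuotientGroup.mk' K) := by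
      have : (QuotientGroup.mk' K) x ∈ H'.map (QuotientGroup.mk' K) := ⟨x, hx, rfl⟩
      rwa [Subgroup.map_sup, QuotientGroup.map_mk'_self, bot_sup_eq] at this
    obtain ⟨y, hy, hyx⟩ := hx'
    obtain ⟨n, hn⟩ := P.2 ⟨y, hy⟩
    refine ⟨n, ?_⟩
    have hn' : y ^ p ^ n = 1 := congrArg Subtype.val hn
    have : (QuotientGroup.mk' K) (x ^ p ^ n) = 1 := by
      rw [map_pow, ← hyx, ← map_pow, hn', map_one]
    exact Subgroup.mem_subgroupOf.1 ((QuotientGroup.eq_one_iff _).1 this)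
  refine ⟨H, ⟨p, hp, c, hcH, ?_, hHt⟩, ?_⟩
  · rintro _ ⟨x, -, rfl⟩
    exact (Subgroup.mem_normalizer_iff.1 x.2 c).1 (Subgroup.mem_zpowers c)
  -- `H` modulo `zpowers c` is a `p`-group, so an element of order prime to `p` dies in it.
  have hmem : ∀ y ∈ H, orderOf y = m → y ∈ Subgroup.zpowers c := by
    intro y hy hym
    obtain ⟨n, hn⟩ := hHt y hy
    have hcop : (orderOf y).Coprime (p ^ n) :=
      hym ▸ (Nat.Coprime.pow_left n ((Nat.Prime.coprime_iff_not_dvd hp).2 hm)).symm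
    obtain ⟨j, hj⟩ := exists_pow_eq_self_of_coprime hcop.symm
    rw [← hj]
    exact Subgroup.pow_mem _ hn j
  -- The coset of `x` is fixed by `c` exactly when `x⁻¹ * c * x` lies in `H`. Having order `m`, this
  -- conjugate then lies in `zpowers c`, so `x` normalizes `zpowers c`. The number of such cosets is
  -- the index of `H'` in `N`, which divides that of a Sylow subgroup.
  have hfix : MulAction.fixedBy (Q ⧸ H) c = MulAction.orbit N ((1 : Q) : Q ⧸ H) := by
    ext x
    obtain ⟨x, rfl⟩ := QuotientGroup.mk_surjective x
    constructor
    · intro h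
      have h1 : x⁻¹ * c * x ∈ H := by
        have : ((c * x : Q) : Q ⧸ H) = x := h
        have := H.inv_mem (QuotientGroup.eq.1 this)
        convert this using 1
        group
      have h2 : x⁻¹ * c * x⁻¹⁻¹ ∈ Subgroup.zpowers c := by
        rw [inv_inv]
        refine hmem _ h1 ?_
        rw [← hco]
        simpa using (MulAut.conj x⁻¹).orderOf_eq c
      have h3 : x⁻¹ ∈ N := Subgroup.mem_normalizer_fintype fun n hn => conj_mem_zpowers h2 hn
      exact ⟨⟨x, by simpa using N.inv_mem h3⟩, congrArg QuotientGroup.mk (mul_one x)⟩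
    · rintro ⟨y, hy⟩
      rw [← hy]
      have h1 : ((y : Q) * 1)⁻¹ * c * ((y : Q) * 1) ∈ H := by
        refine Subgroup.zpowers_le.2 hcH ?_
        simpa using (Subgroup.mem_normalizer_iff.1 (N.inv_mem y.2) c).1 (Subgroup.mem_zpowers c)
      refine QuotientGroup.eq.2 ?_
      convert H.inv_mem h1 using 1
      simp [mul_assoc]
  have hidx : ¬ p ∣ Nat.card (MulAction.fixedBy (Q ⧸ H) c) := by
    have hst : MulAction.stabilizer N ((1 : Q) : Q ⧸ H) = H' := by
      ext y
      have h1 : y • ((1 : Q) : Q ⧸ H) = ((y : Q) : Q ⧸ H) := congrArg QuotientGroup.mk (mul_one _)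
      rw [MulAction.mem_stabilizer_iff, h1, eq_comm, QuotientGroup.eq, inv_one, one_mul]
      exact Subgroup.mem_map_iff_mem Subtype.val_injective
    rw [hfix, Nat.card_coe_set_eq, ← MulAction.index_stabilizer, hst]
    exact fun h => P.not_dvd_index (h.trans (Subgroup.index_dvd_of_le le_sup_right))
  classical
  have := Fintype.ofFinite (Q ⧸ H)
  have hgY : ∀ y ∈ MulAction.fixedBy (Q ⧸ H) c, g • y ∈ MulAction.fixedBy (Q ⧸ H) c := by
    intro y hy
    have : c * g = g * c := by rw [hc, ← pow_succ, ← pow_succ']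
    rw [MulAction.mem_fixedBy, smul_smul, this, mul_smul, hy]
  -- On the fixed points of `c`, the action of `g` has order dividing `p ^ a`, as `g ^ p ^ a = c`.
  -- So `g` and `c` have the same number of fixed points modulo `p`.
  let f : Function.End (MulAction.fixedBy (Q ⧸ H) c) := fun y => ⟨g • y, hgY y y.2⟩
  have hfn : ∀ (n : ℕ) y, (((f ^ n) y : MulAction.fixedBy (Q ⧸ H) c) : Q ⧸ H)
      = g ^ n • (y : Q ⧸ H) := by
    intro n
    induction n with
    | zero =>
      intro y
      rw [pow_zero, pow_zero, one_smul]
      rfl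
    | succ n ih =>
      intro y
      rw [pow_succ, pow_succ, mul_smul]
      exact ih (f y)
  have hf : f ^ p ^ a = 1 := by
    funext y
    exact Subtype.ext ((hfn _ y).trans y.2)
  have hmod := Equiv.Perm.card_fixedPoints_modEq hf
  have hcard : Fintype.card f.fixedPoints = Nat.card (MulAction.fixedBy (Q ⧸ H) g) := by
    rw [← Nat.card_eq_fintype_card]
    refine Nat.card_congr ⟨fun y => ⟨y.1, congrArg Subtype.val y.2⟩, fun y => ⟨⟨y, ?_⟩, ?_⟩,
      fun _ => rfl, fun _ => rfl⟩
    · exact Subgroup.pow_mem (MulAction.stabilizer Q (y : Q ⧸ H)) y.2 _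
    · exact Subtype.ext y.2
  rw [hcard, ← Nat.card_eq_fintype_card] at hmod
  intro hdvd
  exact hidx ((Nat.modEq_zero_iff_dvd.1 (hmod.trans (Nat.modEq_zero_iff_dvd.2 hdvd))))

/-- **Solomon's induction theorem**: the trivial permutation character is a difference of two
permutation characters with quasi-elementary stabilizers. -/
theorem isQuasiElementaryMark_one {Q : Type u} [Group Q] [Finite Q] :
    IsQuasiElementaryMark (1 : Q → ℤ) := by
  have h1 : ∀ g : Q, ∃ f : Q → ℤ, IsQuasiElementaryMark f ∧ f g = 1 := by
    intro g
    -- The values at `g` of all marks form a subgroup of ℤ. A proper subgroup would lie in pℤ for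
    -- some prime `p`, against the preceding lemma.
    let I : AddSubgroup ℤ :=
      { carrier := {n | ∃ f : Q → ℤ, IsQuasiElementaryMark f ∧ f g = n}
        zero_mem' := ⟨0, .zero, rfl⟩
        add_mem' := by
          rintro _ _ ⟨f, hf, rfl⟩ ⟨f', hf', rfl⟩
          exact ⟨f + f', hf.add hf', rfl⟩
        neg_mem' := by
          rintro _ ⟨f, hf, rfl⟩
          exact ⟨-f, hf.neg, rfl⟩ }
    obtain ⟨d, hd⟩ := Int.subgroup_cyclic I
    suffices (1 : ℤ) ∈ I from this
    rw [← AddSubgroup.zmultiples_eq_closure] at hd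
    rw [hd, Int.mem_zmultiples_iff]
    by_contra hd1
    obtain ⟨p, hp, hpd⟩ := Nat.exists_prime_and_dvd (n := d.natAbs) fun h =>
      hd1 (isUnit_iff_dvd_one.1 (Int.isUnit_iff_natAbs_eq.2 h))
    obtain ⟨H, hH, hpH⟩ := exists_isQuasiElementary_not_dvd_card_fixedBy g hp
    apply hpH
    have : (Nat.card (MulAction.fixedBy (Q ⧸ H) g) : ℤ) ∈ I := by
      refine ⟨fun g => Nat.card (MulAction.fixedBy (Q ⧸ H) g), ?_, rfl⟩
      refine .of_isQuasiElementary_stabilizer fun x => ?_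
      obtain ⟨x, rfl⟩ := QuotientGroup.mk_surjective x
      rw [show (QuotientGroup.mk x : Q ⧸ H) = x • ((1 : Q) : Q ⧸ H) from
        congrArg QuotientGroup.mk (mul_one x).symm, MulAction.stabilizer_smul_eq_stabilizer_map_conj]
      exact (hH.mono (MulAction.stabilizer_quotient H).le).map _
    rw [hd, Int.mem_zmultiples_iff] at this
    exact_mod_cast (Int.natCast_dvd.2 hpd).trans this
  choose F hF hF1 using h1
  have := Fintype.ofFinite Q
  -- The factor indexed by `g` vanishes at `g`, so the product is the zero function. Expanded, 1
  -- minus the product has no constant term and stays in the ring of marks.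
  have h2 : IsQuasiElementaryMark (1 - ∏ g, (1 - F g)) := by
    refine Finset.prod_induction (fun g => 1 - F g) (fun h => IsQuasiElementaryMark (1 - h)) ?_ ?_ ?_
    · intro a b ha hb
      have : 1 - a * b = (1 - a) + (1 - b) + -((1 - a) * (1 - b)) := by ring
      rw [this]
      exact (ha.add hb).add (ha.mul hb).neg
    · simpa using .zero
    · intro g _
      simpa using hF g
  convert h2
  ext g
  rw [Pi.sub_apply, Finset.prod_apply, Finset.prod_eq_zero (Finset.mem_univ g)] <;> simp [hF1]

/-! ### Projective representations and monomiality -/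

section Monomial

variable {k G W : Type*} [Field k] [Group G] [AddCommGroup W] [Module k W]

/-- A projective representation of `G` on `W`, with an unspecified multiplier. -/
structure IsProjRep (ρ : G → Module.End k W) : Prop where
  one : ρ 1 = 1
  mul : ∀ x y, ∃ c : k, c ≠ 0 ∧ ∀ w, ρ x (ρ y w) = c • ρ (x * y) w

/-- The subspace `A` has a basis whose lines are permuted by the elements of `S`. -/
def IsMonomialOn (ρ : G → Module.End k W) (S : Subgroup G) (A : Submodule k W) : Prop :=
  ∃ (n : ℕ) (v : Fin n → W), LinearIndependent k v ∧ Submodule.span k (Set.range v) = A ∧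
    ∀ s ∈ S, ∀ i, ∃ j, ∃ c : k, ρ s (v i) = c • v j

theorem IsMonomialOn.of_finite {ρ : G → Module.End k W} {S : Subgroup G} {ι : Type*} [Finite ι]
    (v : ι → W) (hv : LinearIndependent k v)
    (h : ∀ s ∈ S, ∀ i, ∃ j, ∃ c : k, ρ s (v i) = c • v j) :
    IsMonomialOn ρ S (Submodule.span k (Set.range v)) := by
  obtain ⟨n, ⟨e⟩⟩ := Finite.exists_equiv_fin ι
  refine ⟨n, v ∘ e.symm, hv.comp _ e.symm.injective, by rw [e.symm.surjective.range_comp],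
    fun s hs i => ?_⟩
  obtain ⟨j, c, hj⟩ := h s hs (e.symm i)
  exact ⟨e j, c, by simpa using hj⟩

namespace IsProjRep

variable {ρ : G → Module.End k W}

theorem injective (hρ : IsProjRep ρ) (g : G) : Function.Injective (ρ g) := by
  rw [injective_iff_map_eq_zero]
  intro w hw
  obtain ⟨c, hc, h⟩ := hρ.mul g⁻¹ g
  have := h w
  rw [hw, map_zero, inv_mul_cancel, hρ.one, Module.End.one_apply] at this
  exact (smul_eq_zero.1 this.symm).resolve_left hc

/-- The elements of `G` acting on `A` by a scalar. -/
def scalarOn (hρ : IsProjRep ρ) (A : Submodule k W) : Subgroup G where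
  carrier := {g | ∃ c : k, ∀ w ∈ A, ρ g w = c • w}
  one_mem' := ⟨1, fun w _ => by simp [hρ.one]⟩
  mul_mem' := by
    rintro x y ⟨a, ha⟩ ⟨b, hb⟩
    obtain ⟨c, hc, h⟩ := hρ.mul x y
    refine ⟨c⁻¹ * (b * a), fun w hw => ?_⟩
    rw [mul_smul, eq_inv_smul_iff₀ hc, ← h, hb w hw, map_smul, ha w hw, smul_smul]
  inv_mem' := by
    rintro x ⟨a, ha⟩
    obtain ⟨c, hc, h⟩ := hρ.mul x⁻¹ x
    refine ⟨a⁻¹ * c, fun w hw => ?_⟩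
    have := h w
    rw [inv_mul_cancel, hρ.one, Module.End.one_apply, ha w hw, map_smul] at this
    -- The scalar can vanish only when `A` is zero, where any scalar will do.
    rcases eq_or_ne a 0 with rfl | h0
    · rw [zero_smul] at this
      rw [(smul_eq_zero.1 this.symm).resolve_left hc]
      simp
    · rw [mul_smul, eq_inv_smul_iff₀ h0, this]

theorem scalarOn_anti (hρ : IsProjRep ρ) {A B : Submodule k W} (h : A ≤ B) :
    hρ.scalarOn B ≤ hρ.scalarOn A :=
  fun _ ⟨c, hc⟩ => ⟨c, fun w hw => hc w (h hw)⟩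

/-- Up to nonzero scalars the conjugate acts as `ρ x ∘ ρ g ∘ ρ x⁻¹`, and the middle factor is a
homothety on the vectors that `ρ x⁻¹` brings back into `A`. -/
theorem conj_mem_scalarOn (hρ : IsProjRep ρ) {A : Submodule k W} {x g : G}
    (hx : ∀ w ∈ A, ρ x⁻¹ w ∈ A) (hg : g ∈ hρ.scalarOn A) : x * g * x⁻¹ ∈ hρ.scalarOn A := by
  obtain ⟨a, ha⟩ := hg
  obtain ⟨c, hc, h⟩ := hρ.mul (x * g) x⁻¹
  obtain ⟨d, hd, h'⟩ := hρ.mul x g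
  obtain ⟨e, he, h''⟩ := hρ.mul x x⁻¹
  refine ⟨c⁻¹ * (d⁻¹ * (a * e)), fun w hw => ?_⟩
  rw [mul_smul, eq_inv_smul_iff₀ hc, ← h, mul_smul, eq_inv_smul_iff₀ hd, ← h', ha _ (hx w hw),
    map_smul, h'', mul_inv_cancel, hρ.one, Module.End.one_apply, mul_smul]

/-- The elements acting by scalars form a normal subgroup. -/
theorem normal_scalarOn_top (hρ : IsProjRep ρ) : (hρ.scalarOn ⊤).Normal :=
  ⟨fun _ hg _ => hρ.conj_mem_scalarOn (fun _ _ => trivial) hg⟩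

/-- If the members of an independent family of subspaces are permuted, the permutation is a group
action. -/
theorem exists_mulAction (hρ : IsProjRep ρ) {S : Subgroup G} {I : Type*} {A : I → Submodule k W}
    (hA : iSupIndep A) (hne : ∀ i, A i ≠ ⊥) (h : ∀ s ∈ S, ∀ i, ∃ j, ∀ w ∈ A i, ρ s w ∈ A j) :
    ∃ _ : MulAction S I, ∀ (s : S) (i : I), ∀ w ∈ A i, ρ s w ∈ A (s • i) := by
  choose act hact using fun s : S => h s s.2
  -- A nonzero vector cannot lie in two distinct members of an independent family, so the target
  -- index is unique. Uniqueness gives the action axioms, multipliers being invisible to subspaces.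
  have huniq : ∀ (s : S) i j, (∀ w ∈ A i, ρ s w ∈ A j) → j = act s i := by
    intro s i j hj
    by_contra hji
    obtain ⟨w, hw, hw0⟩ := (A i).ne_bot_iff.1 (hne i)
    have := Submodule.disjoint_def.1 (hA.pairwiseDisjoint hji) _ (hj w hw) (hact s i w hw)
    exact hw0 (hρ.injective s (this.trans (map_zero _).symm))
  refine ⟨{ smul := act, mul_smul := fun s t i => ?_, one_smul := fun i => ?_ }, hact⟩
  rotate_left
  · exact (huniq 1 i i fun w hw => by simpa [hρ.one] using hw).symm
  · refine (huniq (s * t) i (act s (act t i)) fun w hw => ?_).symm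
    obtain ⟨c, hc, h⟩ := hρ.mul s t
    have h1 := (A (act s (act t i))).smul_mem c⁻¹ (hact s _ _ (hact t i w hw))
    rwa [h, inv_smul_smul₀ hc] at h1

/-- If the members of an independent family of subspaces are permuted and each of them is monomial
for its stabilizer, then their sum is monomial. -/
theorem isMonomialOn_iSup (hρ : IsProjRep ρ) {S : Subgroup G} {I : Type*} [Finite I]
    [MulAction S I] {A : I → Submodule k W} (hA : iSupIndep A)
    (hact : ∀ (s : S) (i : I), ∀ w ∈ A i, ρ s w ∈ A (s • i))
    (hmon : ∀ i, IsMonomialOn ρ ((MulAction.stabilizer S i).map S.subtype) (A i)) :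
    IsMonomialOn ρ S (⨆ i, A i) := by
  choose n u hu hspan hperm using hmon
  -- `r i` is a chosen representative of the orbit of `i`, and `t i` carries `r i` to `i`. The basis
  -- of `A i` is transported from that of `A (r i)` by `t i`, so all blocks of an orbit carry
  -- compatible bases.
  let r : I → I := fun i => (Quotient.mk (MulAction.orbitRel S I) i).out
  have hr : ∀ i, ∃ t : S, t • r i = i := fun i =>
    MulAction.orbitRel_apply.1
      ((MulAction.orbitRel S I).symm (Quotient.mk_out (s := MulAction.orbitRel S I) i))
  have hrs : ∀ (s : S) i, r (s • i) = r i := fun s i =>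
    congrArg Quotient.out (Quotient.sound (s := MulAction.orbitRel S I)
      (MulAction.orbitRel_apply.2 (MulAction.mem_orbit i s)))
  choose t ht using hr
  let v : ∀ i, Fin (n (r i)) → W := fun i a => ρ (t i) (u (r i) a)
  have hv : ∀ i, LinearIndependent k (v i) := fun i =>
    (hu (r i)).map' (ρ (t i)) (LinearMap.ker_eq_bot.2 (hρ.injective _))
  have hvs : ∀ i, Submodule.span k (Set.range (v i)) = A i := by
    intro i
    have : Submodule.span k (Set.range (v i)) = (A (r i)).map (ρ (t i)) := by
      rw [← hspan (r i), Submodule.map_span, ← Set.range_comp]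
      rfl
    rw [this]
    refine le_antisymm (Submodule.map_le_iff_le_comap.2 fun w hw => ?_) fun w hw => ?_
    · have := hact (t i) _ w hw
      rwa [ht] at this
    · obtain ⟨c, hc, h⟩ := hρ.mul (t i) (t i)⁻¹
      have h1 := hact (t i)⁻¹ i w hw
      rw [show (t i)⁻¹ • i = r i by rw [inv_smul_eq_iff, ht]] at h1
      refine ⟨c⁻¹ • ρ (t i)⁻¹ w, Submodule.smul_mem _ _ (by simpa using h1), ?_⟩
      rw [map_smul, h, mul_inv_cancel, hρ.one, Module.End.one_apply, inv_smul_smul₀ hc]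
  have hli : LinearIndependent k fun a : Σ i, Fin (n (r i)) => v a.1 a.2 := by
    refine linearIndependent_iUnion_finite hv fun i s _ his => ?_
    simp_rw [hvs]
    exact (hA i).mono_right (iSup₂_le fun j hj =>
      le_iSup₂_of_le j (by rintro rfl; exact his hj) le_rfl)
  have hsp : Submodule.span k (Set.range fun a : Σ i, Fin (n (r i)) => v a.1 a.2) = ⨆ i, A i := by
    rw [Set.range_sigma_eq_iUnion_range, Submodule.span_iUnion]
    exact iSup_congr hvs
  rw [← hsp]
  refine IsMonomialOn.of_finite _ hli ?_
  rintro s hs ⟨i, a⟩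
  set i' : I := (⟨s, hs⟩ : S) • i with hi'
  have key : ∃ a' : Fin (n (r i)), ∃ c : k, ρ s (v i a) = c • ρ (t i') (u (r i) a') := by
    -- This element stabilizes the representative `r i`, whose basis lines it permutes; multiplying
    -- back by `t i'` recovers the action of `s`.
    let x : S := (t i')⁻¹ * ⟨s, hs⟩ * t i
    have hx : x ∈ MulAction.stabilizer S (r i) := by
      rw [MulAction.mem_stabilizer_iff, mul_smul, mul_smul, ht, inv_smul_eq_iff, ← hi',
        ← hrs ⟨s, hs⟩ i, ht]
    obtain ⟨a', c, h⟩ := hperm (r i) x ⟨x, hx, rfl⟩ a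
    obtain ⟨d, hd, h1⟩ := hρ.mul s (t i)
    obtain ⟨e, he, h2⟩ := hρ.mul (t i') x
    refine ⟨a', d * (e⁻¹ * c), ?_⟩
    have h3 : (t i' : G) * x = s * t i := by simp [x, mul_assoc]
    have h4 := h2 (u (r i) a)
    rw [h, map_smul, h3] at h4
    rw [h1, mul_smul, mul_smul, h4, inv_smul_smul₀ he]
  rw [← hrs ⟨s, hs⟩ i] at key
  obtain ⟨a', c, h⟩ := key
  exact ⟨⟨i', a'⟩, c, h⟩

/-- If some power of `ρ g` is a scalar, then `ρ g` is diagonalizable. -/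
theorem iSup_eigenspace_eq_top [IsAlgClosed k] [CharZero k] [FiniteDimensional k W]
    (hρ : IsProjRep ρ) {g : G} {n : ℕ} (hn : n ≠ 0) (hg : g ^ n ∈ hρ.scalarOn ⊤) :
    ⨆ μ : k, (ρ g).eigenspace μ = ⊤ := by
  have hpow : ∀ m : ℕ, ∃ c : k, c ≠ 0 ∧ ∀ w, (ρ g ^ m) w = c • ρ (g ^ m) w := by
    intro m
    induction m with
    | zero => exact ⟨1, one_ne_zero, fun w => by simp [hρ.one]⟩
    | succ m ih =>
      obtain ⟨c, hc, h⟩ := ih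
      obtain ⟨d, hd, h'⟩ := hρ.mul (g ^ m) g
      refine ⟨c * d, mul_ne_zero hc hd, fun w => ?_⟩
      rw [pow_succ, Module.End.mul_apply, h, h', pow_succ, mul_smul]
  obtain ⟨c, hc, h⟩ := hpow n
  obtain ⟨a, ha⟩ := hg
  rcases subsingleton_or_nontrivial W with _ | _
  · exact Subsingleton.elim _ _
  have ha0 : a ≠ 0 := by
    rintro rfl
    obtain ⟨w, hw⟩ := exists_ne (0 : W)
    refine hw (hρ.injective (g ^ n) ?_)
    rw [ha w trivial, zero_smul, map_zero]
  refine Module.End.IsSemisimple.iSup_eigenspace_eq_top ?_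
  -- The `n`-th power of `ρ g` is the nonzero scalar `c * a`, and `X ^ n - c * a` is separable in
  -- characteristic zero.
  refine Module.End.isSemisimple_of_squarefree_aeval_eq_zero
    (p := Polynomial.X ^ n - Polynomial.C (c * a)) ?_ ?_
  · exact (Polynomial.separable_X_pow_sub_C (c * a) (Nat.cast_ne_zero.2 hn)
      (mul_ne_zero hc ha0)).squarefree
  · ext w
    simp [h, ha w trivial, Module.algebraMap_end_apply, smul_comm c a]

/-- A projective representation of a quasi-elementary group is monomial. -/
theorem isMonomialOn_of_isQuasiElementary [IsAlgClosed k] [CharZero k] [FiniteDimensional k W]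
    (hρ : IsProjRep ρ) {Q : Type*} [Group Q] [Finite Q] (f : G →* Q)
    (hf : f.ker ≤ hρ.scalarOn ⊤) (S : Subgroup G) (A : Submodule k W)
    (hSA : ∀ s ∈ S, ∀ w ∈ A, ρ s w ∈ A) (hS : IsQuasiElementary (S.map f)) :
    IsMonomialOn ρ S A := by
  induction hd : Module.finrank k A using Nat.strong_induction_on generalizing S A with
  | _ d ih =>
  by_cases hSM : S ≤ hρ.scalarOn A
  · let b := Module.finBasis k A
    have hb : Submodule.span k (Set.range fun i => (b i : W)) = A := by
      have := congrArg (Submodule.map A.subtype) b.span_eq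
      rwa [Submodule.map_span, ← Set.range_comp, Submodule.map_top, Submodule.range_subtype] at this
    rw [← hb]
    refine IsMonomialOn.of_finite _ (b.linearIndependent.map' A.subtype A.ker_subtype) ?_
    intro s hs i
    obtain ⟨c, hc⟩ := hSM hs
    exact ⟨i, c, hc _ (b i).2⟩
  have hkA : f.ker ≤ hρ.scalarOn A := hf.trans (hρ.scalarOn_anti le_top)
  set M := S ⊓ hρ.scalarOn A with hM
  -- The kernel of `f` acts by scalars, so an element of `S` with the same image as an element of
  -- `M` is itself in `M`.
  have hlt : M.map f < S.map f := by
    refine lt_of_le_of_ne (Subgroup.map_mono inf_le_left) fun h => hSM fun s hs => ?_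
    obtain ⟨m, hm, hms⟩ : f s ∈ M.map f := h ▸ ⟨s, hs, rfl⟩
    have h1 : m⁻¹ * s ∈ f.ker := by rw [MonoidHom.mem_ker, map_mul, map_inv, hms, inv_mul_cancel]
    have := (hρ.scalarOn A).mul_mem hm.2 (hkA h1)
    rwa [mul_inv_cancel_left] at this
  obtain ⟨_, ⟨s, hs, rfl⟩, hsM, hconj⟩ := hS.exists_normal_cyclic hlt (by
    rintro _ ⟨x, hx, rfl⟩ _ ⟨m, hm, rfl⟩
    refine ⟨x * m * x⁻¹, ⟨S.mul_mem (S.mul_mem hx hm.1) (S.inv_mem hx), ?_⟩, by simp⟩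
    exact hρ.conj_mem_scalarOn (hSA _ (S.inv_mem hx)) hm.2)
  have hs' : s ∉ hρ.scalarOn A := fun h => hsM ⟨s, ⟨hs, h⟩, rfl⟩
  -- The eigenspaces of `ρ s` on `A` are permuted by `S`.
  let E : k → Submodule k W := fun μ => A ⊓ (ρ s).eigenspace μ
  have hEtop : ⨆ μ, E μ = A := by
    have h1 := hρ.iSup_eigenspace_eq_top (g := s) (n := Nat.card Q) Nat.card_pos.ne'
      (hf (by rw [MonoidHom.mem_ker, map_pow, pow_card_eq_one']))
    exact (Submodule.eq_iSup_inf_genEigenspace 1 (hSA s hs) h1).symm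
  have hEind : iSupIndep E := (Module.End.eigenspaces_iSupIndep (ρ s)).mono fun _ => inf_le_right
  let I := {μ : k // E μ ≠ ⊥}
  have : Finite I := Submodule.finite_ne_bot_of_iSupIndep hEind
  let A' : I → Submodule k W := fun i => E i
  have hA'ind : iSupIndep A' := hEind.comp Subtype.val_injective
  have hA'top : ⨆ i, A' i = A := (iSup_ne_bot_subtype E).trans hEtop
  have hperm : ∀ x ∈ S, ∀ i, ∃ j, ∀ w ∈ A' i, ρ x w ∈ A' j := by
    intro x hx i
    obtain ⟨n, _, ⟨m, hm, rfl⟩, h⟩ := hconj (f x⁻¹) ⟨x⁻¹, S.inv_mem hx, rfl⟩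
    -- Modulo `f.ker` the conjugate is `s ^ n * m`, and `s`, `m` and the kernel all act by scalars
    -- on an eigenspace of `s`. Hence `ρ x` maps it into a single eigenspace, the eigenvalue
    -- changing by multiplier values.
    have h1 : x⁻¹ * s * x ∈ hρ.scalarOn (A' i) := by
      have hsi : s ∈ hρ.scalarOn (A' i) :=
        ⟨i, fun w hw => Module.End.mem_eigenspace_iff.1 hw.2⟩
      have hmi : m ∈ hρ.scalarOn (A' i) := hρ.scalarOn_anti inf_le_left hm.2
      have hk : (s ^ n * m)⁻¹ * (x⁻¹ * s * x) ∈ f.ker := by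
        rw [MonoidHom.mem_ker, map_mul, map_inv, inv_mul_eq_one]
        simp only [map_mul, map_zpow, map_inv, inv_inv] at h ⊢
        exact h.symm
      have := (hρ.scalarOn (A' i)).mul_mem ((hρ.scalarOn (A' i)).mul_mem
        ((hρ.scalarOn (A' i)).zpow_mem hsi n) hmi) (hf.trans (hρ.scalarOn_anti le_top) hk)
      rwa [mul_inv_cancel_left] at this
    obtain ⟨c, hc⟩ := h1
    obtain ⟨d, hd, h2⟩ := hρ.mul s x
    obtain ⟨e, he, h3⟩ := hρ.mul x (x⁻¹ * s * x)
    have h4 : ∀ w ∈ A' i, ρ x w ∈ E (d * e⁻¹ * c) := by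
      refine fun w hw => ⟨hSA x hx w hw.1, Module.End.mem_eigenspace_iff.2 ?_⟩
      have h5 := h3 w
      rw [hc w hw, map_smul, show x * (x⁻¹ * s * x) = s * x by group] at h5
      rw [h2, mul_smul, mul_smul, h5, inv_smul_smul₀ he]
    obtain ⟨w, hw, hw0⟩ := (A' i).ne_bot_iff.1 i.2
    refine ⟨⟨d * e⁻¹ * c, (Submodule.ne_bot_iff _).2 ⟨ρ x w, h4 w hw, fun h0 => hw0 ?_⟩⟩, h4⟩
    exact hρ.injective x (h0.trans (map_zero _).symm)
  obtain ⟨_, hact⟩ := hρ.exists_mulAction hA'ind (fun i => i.2) hperm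
  rw [← hA'top]
  refine hρ.isMonomialOn_iSup hA'ind hact fun i => ?_
  -- The dimension drops: an eigenspace equal to `A` would make `s` a scalar on `A`.
  refine ih _ ?_ _ _ ?_ (hS.mono (Subgroup.map_mono ?_)) rfl
  · rw [← hd]
    refine Submodule.finrank_lt_finrank_of_lt (lt_of_le_of_ne inf_le_left fun h => hs' ?_)
    rw [← h]
    exact ⟨i, fun w hw => Module.End.mem_eigenspace_iff.1 hw.2⟩
  · rintro _ ⟨x, hx, rfl⟩ w hw
    have := hact x i w hw
    rwa [MulAction.mem_stabilizer_iff.1 hx] at this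
  · rintro _ ⟨x, -, rfl⟩
    exact x.2

end IsProjRep

end Monomial

/-! ### Additive invariants of representations of a finite group -/

section Character

variable {k : Type*} [Field k] {Q : Type*} [Group Q]

/-- The short sequence `0 → M → N → P → 0` is exact and equivariant. -/
structure IsShortExact {G M N P : Type*} [AddCommGroup M] [Module k M]
    [AddCommGroup N] [Module k N] [AddCommGroup P] [Module k P]
    (ρM : G → Module.End k M) (ρN : G → Module.End k N) (ρP : G → Module.End k P)
    (i : M →ₗ[k] N) (p : N →ₗ[k] P) : Prop where
  injective : Function.Injective i
  surjective : Function.Surjective p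
  exact : LinearMap.range i = LinearMap.ker p
  map_left : ∀ g m, i (ρM g m) = ρN g (i m)
  map_right : ∀ g n, p (ρN g n) = ρP g (p n)

theorem IsShortExact.subtype_mkQ {G N : Type*} [AddCommGroup N] [Module k N]
    {ρ : G → Module.End k N} (A : Submodule k N) (h : ∀ g, A ≤ A.comap (ρ g)) :
    IsShortExact (fun g => (ρ g).restrict (h g)) ρ (fun g => A.mapQ A (ρ g) (h g))
      A.subtype A.mkQ :=
  ⟨A.injective_subtype, A.mkQ_surjective, by simp, fun _ _ => rfl, fun _ _ => rfl⟩

/-- Linear splittings write `ρN g` as a sum of one map factoring through `M` and one through `P`;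
cyclicity of the trace turns these into `ρM g` and `ρP g`. -/
theorem IsShortExact.trace_eq {G M N P : Type*} [AddCommGroup M] [Module k M]
    [AddCommGroup N] [Module k N] [AddCommGroup P] [Module k P]
    [FiniteDimensional k M] [FiniteDimensional k N] [FiniteDimensional k P]
    {ρM : G → Module.End k M} {ρN : G → Module.End k N} {ρP : G → Module.End k P}
    {i : M →ₗ[k] N} {p : N →ₗ[k] P} (h : IsShortExact ρM ρN ρP i p) (g : G) :
    LinearMap.trace k N (ρN g) = LinearMap.trace k M (ρM g) + LinearMap.trace k P (ρP g) := by
  obtain ⟨s, hs⟩ := p.exists_rightInverse_of_surjective (LinearMap.range_eq_top.2 h.surjective)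
  obtain ⟨r, hr⟩ := i.exists_leftInverse_of_injective (LinearMap.ker_eq_bot.2 h.injective)
  have hs' : ∀ x, p (s x) = x := fun x => LinearMap.congr_fun hs x
  have hr' : ∀ x, r (i x) = x := fun x => LinearMap.congr_fun hr x
  set q : N →ₗ[k] M := r ∘ₗ (LinearMap.id - s ∘ₗ p) with hq
  have hpi : ∀ x, p (i x) = 0 := fun x => by
    have : i x ∈ LinearMap.ker p := h.exact ▸ ⟨x, rfl⟩
    exact this
  have h1 : ρN g = (ρN g ∘ₗ i) ∘ₗ q + (ρN g ∘ₗ s) ∘ₗ p := by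
    ext x
    obtain ⟨y, hy⟩ : x - s (p x) ∈ LinearMap.range i := by
      rw [h.exact, LinearMap.mem_ker, map_sub, hs', sub_self]
    have h3 : q x = y := by
      simp only [hq, LinearMap.comp_apply, LinearMap.sub_apply, LinearMap.id_apply, ← hy, hr']
    simp only [LinearMap.add_apply, LinearMap.comp_apply, h3, ← map_add, hy]
    simp
  rw [h1, map_add, LinearMap.trace_comp_comm' q, LinearMap.trace_comp_comm' p]
  congr 2
  · ext x
    simp [hq, ← h.map_left, hpi, hr']
  · ext x
    simp [h.map_right, hs']

/-- Finite-dimensional representations of a finite group with the same character have the same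
value under any additive invariant. -/
theorem eq_of_character_eq [CharZero k] [Finite Q] {X : Type*} [AddCommGroup X]
    (T : ∀ (M : Type v) [AddCommGroup M] [Module k M] [FiniteDimensional k M],
      Representation k Q M → X)
    (hT : ∀ (M N P : Type v) [AddCommGroup M] [Module k M] [FiniteDimensional k M]
      [AddCommGroup N] [Module k N] [FiniteDimensional k N]
      [AddCommGroup P] [Module k P] [FiniteDimensional k P]
      (ρM : Representation k Q M) (ρN : Representation k Q N) (ρP : Representation k Q P)
      (i : M →ₗ[k] N) (p : N →ₗ[k] P), IsShortExact ρM ρN ρP i p → T N ρN = T M ρM + T P ρP)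
    (A B : Type v) [AddCommGroup A] [Module k A] [FiniteDimensional k A]
    [AddCommGroup B] [Module k B] [FiniteDimensional k B]
    (σ : Representation k Q A) (τ : Representation k Q B) (h : σ.character = τ.character) :
    T A σ = T B τ := by
  have hzero : ∀ (M : Type v) [AddCommGroup M] [Module k M] [FiniteDimensional k M]
      (ρ : Representation k Q M), Module.finrank k M = 0 → T M ρ = 0 := by
    intro M _ _ _ ρ hM
    have := Module.finrank_zero_iff.1 hM
    have h := hT M M M ρ ρ ρ LinearMap.id LinearMap.id
      ⟨fun _ _ h => h, fun x => ⟨x, rfl⟩, Subsingleton.elim _ _, fun _ _ => rfl, fun _ _ => rfl⟩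
    exact left_eq_add.1 h
  induction hd : Module.finrank k A using Nat.strong_induction_on generalizing A B with
  | _ d ih =>
  have hAB : Module.finrank k A = Module.finrank k B := by
    have := congrFun h 1
    rw [Representation.char_one, Representation.char_one] at this
    exact_mod_cast this
  rcases Nat.eq_zero_or_pos d with rfl | hpos
  · rw [hzero A σ hd, hzero B τ (hAB ▸ hd)]
  have := Fintype.ofFinite Q
  have hcard : (Nat.card Q : k) ≠ 0 := Nat.cast_ne_zero.2 Nat.card_pos.ne'
  have := invertibleOfNonzero hcard
  -- Both dimensions are given by the same pairing of characters. As the identity of `σ` is nonzero,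
  -- a nonzero map from `σ` to `τ` exists.
  have hHom : (Module.finrank k (Representation.IntertwiningMap σ σ) : k)
      = Module.finrank k (Representation.IntertwiningMap σ τ) := by
    rw [← Representation.card_inv_mul_sum_char_mul_char_eq_finrank,
      ← Representation.card_inv_mul_sum_char_mul_char_eq_finrank, h]
  have : Nontrivial A := Module.nontrivial_of_finrank_pos (R := k) (hd ▸ hpos)
  have hne : Nontrivial (Representation.IntertwiningMap σ τ) := by
    have hσ : Nontrivial (Representation.IntertwiningMap σ σ) := by
      refine ⟨⟨Representation.IntertwiningMap.id σ, 0, fun h => ?_⟩⟩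
      obtain ⟨a, ha⟩ := exists_ne (0 : A)
      exact ha (DFunLike.congr_fun h a)
    by_contra hτ
    rw [not_nontrivial_iff_subsingleton] at hτ
    rw [Module.finrank_zero_of_subsingleton (M := Representation.IntertwiningMap σ τ),
      Nat.cast_inj] at hHom
    have := Module.Finite.equiv (Representation.invariantsEquivIntertwiningMap σ σ)
    exact not_subsingleton _ (Module.finrank_zero_iff.1 hHom)
  obtain ⟨f, hf⟩ := exists_ne (0 : Representation.IntertwiningMap σ τ)
  set F : A →ₗ[k] B := f.toLinearMap with hF
  have hfg : ∀ g a, F (σ g a) = τ g (F a) := f.isIntertwining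
  have hF0 : F ≠ 0 := fun h => hf (Representation.IntertwiningMap.toLinearMap_injective σ τ h)
  have hK : ∀ g, LinearMap.ker F ≤ (LinearMap.ker F).comap (σ g) := by
    intro g a ha
    rw [Submodule.mem_comap, LinearMap.mem_ker, hfg, LinearMap.mem_ker.1 ha, map_zero]
  have hR : ∀ g, LinearMap.range F ≤ (LinearMap.range F).comap (τ g) := by
    rintro g _ ⟨a, rfl⟩
    exact ⟨σ g a, hfg g a⟩
  -- The image of `F` is common to both sides, so it remains to compare kernel and cokernel. They
  -- have equal characters by additivity of the trace, and the kernel is smaller than `A`.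
  let ρK := σ.subrepresentation _ hK
  let ρR := τ.subrepresentation _ hR
  let ρC := τ.quotient _ hR
  have e1 : IsShortExact ρK σ ρR (LinearMap.ker F).subtype F.rangeRestrict :=
    ⟨Submodule.injective_subtype _, F.surjective_rangeRestrict, by simp, fun _ _ => rfl,
      fun g a => Subtype.ext (hfg g a)⟩
  have e2 : IsShortExact ρR τ ρC (LinearMap.range F).subtype (LinearMap.range F).mkQ :=
    IsShortExact.subtype_mkQ _ hR
  rw [hT _ _ _ _ _ _ _ _ e1, hT _ _ _ _ _ _ _ _ e2, add_comm]
  congr 1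
  refine ih (Module.finrank k (LinearMap.ker F)) ?_ _ _ ρK ρC ?_ rfl
  · rw [← hd]
    exact Submodule.finrank_lt (lt_top_iff_ne_top.2 fun h => hF0 (LinearMap.ker_eq_top.1 h)).ne
  · ext g
    have h1 := e1.trace_eq g
    have h2 := e2.trace_eq g
    have h3 : LinearMap.trace k A (σ g) = LinearMap.trace k B (τ g) := congrFun h g
    rw [h1, h2, add_comm] at h3
    exact add_left_cancel h3

/-! ### Permutation representations and their characters -/

/-- The permutation representation on functions on a `Q`-set. -/
def permRep (k : Type*) [Field k] (Q : Type*) [Group Q] (X : Type*) [MulAction Q X] :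
    Representation k Q (X → k) where
  toFun g := LinearMap.funLeft k k (g⁻¹ • ·)
  map_one' := by
    ext f x
    simp
  map_mul' g h := by
    ext f x
    simp [mul_smul]

theorem permRep_apply {X : Type*} [MulAction Q X] (g : Q) (f : X → k) (x : X) :
    permRep k Q X g f x = f (g⁻¹ • x) := rfl

theorem permRep_single {X : Type*} [MulAction Q X] [DecidableEq X] (g : Q) (x : X) (c : k) :
    permRep k Q X g (Pi.single x c) = Pi.single (g • x) c := by
  ext y
  rw [permRep_apply, Pi.single_apply, Pi.single_apply]
  exact if_congr inv_smul_eq_iff rfl rfl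

theorem character_permRep {X : Type*} [MulAction Q X] [Finite X] (g : Q) :
    (permRep k Q X).character g = Nat.card (MulAction.fixedBy X g) := by
  classical
  have := Fintype.ofFinite X
  rw [Representation.character, LinearMap.trace_eq_matrix_trace k (Pi.basisFun k X), Matrix.trace]
  simp only [Matrix.diag_apply, LinearMap.toMatrix_apply, Pi.basisFun_apply, permRep_single,
    Pi.basisFun_repr, Pi.single_apply]
  rw [Finset.sum_boole, Nat.card_eq_fintype_card, Fintype.card_subtype]
  simp [MulAction.mem_fixedBy, eq_comm]

end Character

/-! ### Admissible functions -/

section Admissible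

variable {ℓ : ℕ} [Fact ℓ.Prime]

theorem exists_finiteDimensional_of_finite {s : Set (PadicAlgCl ℓ)} (hs : s.Finite) :
    ∃ E : IntermediateField ℚ_[ℓ] (PadicAlgCl ℓ), FiniteDimensional ℚ_[ℓ] E ∧ ∀ x ∈ s, x ∈ E := by
  have := hs.to_subtype
  exact ⟨IntermediateField.adjoin ℚ_[ℓ] s,
    IntermediateField.finiteDimensional_adjoin fun x _ => Algebra.IsIntegral.isIntegral x,
    fun x hx => IntermediateField.subset_adjoin _ _ hx⟩

/-- Continuity and density of ℕ in ℤ_ℓ force `φ` to be ℤ_ℓ-linear. Independent elements of its image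
then lift to independent elements of `E`, so the image spans a finite-dimensional ℚ_ℓ-space. This
controls subrings of `C` that are only abstractly isomorphic to `A`. -/
theorem exists_finiteDimensional_of_ringHom {A : Subring (PadicAlgCl ℓ)}
    {E : IntermediateField ℚ_[ℓ] (PadicAlgCl ℓ)} [FiniteDimensional ℚ_[ℓ] E]
    (hAE : ∀ x ∈ A, x ∈ E) (hA : ∀ z : ℤ_[ℓ], algebraMap ℤ_[ℓ] (PadicAlgCl ℓ) z ∈ A)
    (φ : A →+* PadicAlgCl ℓ) (hφ : Continuous φ) :
    ∃ E' : IntermediateField ℚ_[ℓ] (PadicAlgCl ℓ), FiniteDimensional ℚ_[ℓ] E' ∧ ∀ a, φ a ∈ E' := by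
  have hcont : Continuous (algebraMap ℤ_[ℓ] (PadicAlgCl ℓ)) := by
    have h : (algebraMap ℤ_[ℓ] (PadicAlgCl ℓ) : ℤ_[ℓ] → PadicAlgCl ℓ)
        = algebraMap ℚ_[ℓ] (PadicAlgCl ℓ) ∘ algebraMap ℤ_[ℓ] ℚ_[ℓ] := by
      ext z
      exact IsScalarTower.algebraMap_apply ℤ_[ℓ] ℚ_[ℓ] (PadicAlgCl ℓ) z
    rw [h]
    exact (algebraMapCLM ℚ_[ℓ] (PadicAlgCl ℓ)).continuous.comp continuous_subtype_val
  have hφz : ∀ z : ℤ_[ℓ], φ ⟨algebraMap ℤ_[ℓ] (PadicAlgCl ℓ) z, hA z⟩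
      = algebraMap ℤ_[ℓ] (PadicAlgCl ℓ) z := by
    refine congrFun (PadicInt.denseRange_natCast.equalizer (hφ.comp (hcont.subtype_mk hA)) hcont ?_)
    ext n
    have : (⟨algebraMap ℤ_[ℓ] (PadicAlgCl ℓ) n, hA n⟩ : A) = (n : A) :=
      Subtype.ext (map_natCast (algebraMap ℤ_[ℓ] (PadicAlgCl ℓ)) n)
    exact (congrArg φ this).trans ((map_natCast φ n).trans (map_natCast _ n).symm)
  obtain ⟨b, hbs, hspan, hli⟩ := exists_linearIndependent ℚ_[ℓ] (Set.range φ)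
  choose a ha using fun x : b => hbs x.2
  have hla : LinearIndependent ℚ_[ℓ] fun x : b => (⟨a x, hAE _ (a x).2⟩ : E) := by
    refine LinearIndependent.of_comp E.val.toLinearMap ?_
    -- Denominators are cleared because `A` is only known to contain ℤ_ℓ.
    rw [← LinearIndependent.iff_fractionRing ℤ_[ℓ] ℚ_[ℓ]] at hli ⊢
    rw [linearIndependent_iff'] at hli ⊢
    intro s z hz
    refine hli s z ?_
    have h1 : ∑ x ∈ s, (⟨algebraMap ℤ_[ℓ] (PadicAlgCl ℓ) (z x), hA _⟩ : A) * a x = 0 := by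
      ext
      rw [AddSubmonoidClass.coe_finsetSum, Subring.coe_zero, ← hz]
      refine Finset.sum_congr rfl fun x _ => ?_
      rw [Algebra.smul_def]
      rfl
    have h2 := congrArg φ h1
    rw [map_sum, map_zero] at h2
    rw [← h2]
    refine Finset.sum_congr rfl fun x _ => ?_
    rw [map_mul, hφz, ha, Algebra.smul_def]
  have hb : b.Finite := hla.finite
  obtain ⟨E', hE', h⟩ := exists_finiteDimensional_of_finite hb
  refine ⟨E', hE', fun x => ?_⟩
  have h1 : Submodule.span ℚ_[ℓ] b ≤ Subalgebra.toSubmodule E'.toSubalgebra :=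
    Submodule.span_le.2 h
  exact h1 (hspan ▸ Submodule.subset_span ⟨x, rfl⟩)

/-- An admissible subring of `C` is contained in a finite extension of `ℚ_ℓ`. -/
theorem IsAdmissibleRing.exists_finiteDimensional {R : Subring (PadicAlgCl ℓ)}
    (hR : IsAdmissibleRing ℓ R) :
    ∃ E : IntermediateField ℚ_[ℓ] (PadicAlgCl ℓ), FiniteDimensional ℚ_[ℓ] E ∧ ∀ x ∈ R, x ∈ E := by
  have key : ∀ (A : Subring (PadicAlgCl ℓ)) (E : IntermediateField ℚ_[ℓ] (PadicAlgCl ℓ)),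
      FiniteDimensional ℚ_[ℓ] E → (∀ x ∈ A, x ∈ E) →
      (∀ z : ℤ_[ℓ], algebraMap ℤ_[ℓ] (PadicAlgCl ℓ) z ∈ A) → TopRingIso R A →
      ∃ E : IntermediateField ℚ_[ℓ] (PadicAlgCl ℓ), FiniteDimensional ℚ_[ℓ] E ∧
        ∀ x ∈ R, x ∈ E := by
    rintro A E hE hAE hA ⟨e, he⟩
    have hcont : Continuous e.symm := e.toEquiv.continuous_symm_iff.2 he.isOpenMap
    obtain ⟨E', hE', h⟩ := exists_finiteDimensional_of_ringHom hAE hA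
      (R.subtype.comp e.symm.toRingHom) (continuous_subtype_val.comp hcont)
    refine ⟨E', hE', fun x hx => ?_⟩
    simpa using h (e ⟨x, hx⟩)
  have hE : ∀ (E : IntermediateField ℚ_[ℓ] (PadicAlgCl ℓ)) (z : ℤ_[ℓ]),
      algebraMap ℤ_[ℓ] (PadicAlgCl ℓ) z ∈ E := by
    intro E z
    rw [IsScalarTower.algebraMap_apply ℤ_[ℓ] ℚ_[ℓ] (PadicAlgCl ℓ)]
    exact E.algebraMap_mem _
  rcases hR with ⟨-, -, -, n, hn⟩ | ⟨E, hfin, h⟩ | ⟨E, hfin, h⟩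
  · have h1 := congrArg (Subtype.val : R → PadicAlgCl ℓ) hn
    have h2 : (ℓ : PadicAlgCl ℓ) ^ n = 0 := by simpa using h1
    exact absurd (Nat.cast_eq_zero.1 (eq_zero_of_pow_eq_zero h2)) (Fact.out : ℓ.Prime).ne_zero
  · exact key _ E hfin (fun x hx => (Subring.mem_inf.1 hx).1)
      (fun z => Subring.mem_inf.2 ⟨hE E z, isIntegral_algebraMap⟩) h
  · exact key _ E hfin (fun x hx => hx) (hE E) h

/-- A function to `C` is admissible if it is continuous with values in a finite extension of
`ℚ_ℓ`. -/
def IsAdmissibleFun {T : Type*} [TopologicalSpace T] (u : T → PadicAlgCl ℓ) : Prop :=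
  Continuous u ∧ ∃ E : IntermediateField ℚ_[ℓ] (PadicAlgCl ℓ), FiniteDimensional ℚ_[ℓ] E ∧
    ∀ t, u t ∈ E

namespace IsAdmissibleFun

variable {T : Type*} [TopologicalSpace T] {u v : T → PadicAlgCl ℓ}

theorem const (c : PadicAlgCl ℓ) : IsAdmissibleFun fun _ : T => c := by
  obtain ⟨E, hE, h⟩ := exists_finiteDimensional_of_finite (Set.finite_singleton c)
  exact ⟨continuous_const, E, hE, fun _ => h c rfl⟩

theorem add (hu : IsAdmissibleFun u) (hv : IsAdmissibleFun v) :
    IsAdmissibleFun fun t => u t + v t := by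
  obtain ⟨cu, E, hE, hu⟩ := hu
  obtain ⟨cv, F, hF, hv⟩ := hv
  exact ⟨cu.add cv, E ⊔ F, inferInstance,
    fun t => add_mem ((le_sup_left : E ≤ E ⊔ F) (hu t)) ((le_sup_right : F ≤ E ⊔ F) (hv t))⟩

theorem mul (hu : IsAdmissibleFun u) (hv : IsAdmissibleFun v) :
    IsAdmissibleFun fun t => u t * v t := by
  obtain ⟨cu, E, hE, hu⟩ := hu
  obtain ⟨cv, F, hF, hv⟩ := hv
  exact ⟨cu.mul cv, E ⊔ F, inferInstance,
    fun t => mul_mem ((le_sup_left : E ≤ E ⊔ F) (hu t)) ((le_sup_right : F ≤ E ⊔ F) (hv t))⟩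

theorem sum {ι : Type*} (s : Finset ι) {f : ι → T → PadicAlgCl ℓ}
    (h : ∀ i ∈ s, IsAdmissibleFun (f i)) : IsAdmissibleFun fun t => ∑ i ∈ s, f i t := by
  classical
  induction s using Finset.induction_on with
  | empty => simpa using const 0
  | insert a s ha ih =>
    simp_rw [Finset.sum_insert ha]
    exact (h a (Finset.mem_insert_self a s)).add
      (ih fun i hi => h i (Finset.mem_insert_of_mem hi))

theorem comp {S : Type*} [TopologicalSpace S] (hu : IsAdmissibleFun u) {f : S → T}
    (hf : Continuous f) : IsAdmissibleFun fun s => u (f s) := by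
  obtain ⟨cu, E, hE, hu⟩ := hu
  exact ⟨cu.comp hf, E, hE, fun s => hu (f s)⟩

theorem of_discrete [DiscreteTopology T] [Finite T] (u : T → PadicAlgCl ℓ) :
    IsAdmissibleFun u := by
  obtain ⟨E, hE, h⟩ := exists_finiteDimensional_of_finite (Set.finite_range u)
  exact ⟨continuous_of_discreteTopology, E, hE, fun t => h _ ⟨t, rfl⟩⟩

end IsAdmissibleFun

/-- Admissibility of a map to `Aut_C(V)` in terms of its matrix coefficients. -/
theorem isAdmissibleAutMap_iff {T : Type*} [TopologicalSpace T] {V : Type*} [AddCommGroup V]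
    [Module (PadicAlgCl ℓ) V] [FiniteDimensional (PadicAlgCl ℓ) V]
    {f : T → (V ≃ₗ[PadicAlgCl ℓ] V)} : IsAdmissibleAutMap f ↔
      ∀ (φ : V →ₗ[PadicAlgCl ℓ] PadicAlgCl ℓ) (v : V), IsAdmissibleFun fun t => φ (f t v) := by
  constructor
  · rintro ⟨n, b, R, hR, hcont, h⟩ φ v
    obtain ⟨E, hE, hRE⟩ := hR.exists_finiteDimensional
    have h1 : ∀ t, φ (f t v) = ∑ j, ∑ i, b.repr v j * φ (b i) *
        LinearMap.toMatrix b b (f t).toLinearMap i j := by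
      intro t
      conv_lhs => rw [← b.sum_repr v, map_sum, map_sum]
      refine Finset.sum_congr rfl fun j _ => ?_
      rw [map_smul, map_smul, ← b.sum_repr (f t (b j)), map_sum, Finset.smul_sum]
      refine Finset.sum_congr rfl fun i _ => ?_
      simp only [LinearMap.toMatrix_apply, map_smul, smul_eq_mul, LinearEquiv.coe_coe]
      ring
    simp_rw [h1]
    refine IsAdmissibleFun.sum _ fun j _ => IsAdmissibleFun.sum _ fun i _ =>
      (IsAdmissibleFun.const _).mul ⟨(continuous_apply_apply i j).comp hcont, E, hE,
        fun t => hRE _ (h t i j).1⟩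
  · intro h
    let b := Module.finBasis (PadicAlgCl ℓ) V
    have hc : ∀ i j, IsAdmissibleFun fun t => LinearMap.toMatrix b b (f t).toLinearMap i j := by
      intro i j
      simpa [LinearMap.toMatrix_apply] using h (b.coord i) (b j)
    choose hcont E hE hmem using hc
    let F := ⨆ p : Fin (Module.finrank (PadicAlgCl ℓ) V) × Fin (Module.finrank (PadicAlgCl ℓ) V),
      E p.1 p.2
    have hF : FiniteDimensional ℚ_[ℓ] F := IntermediateField.finiteDimensional_iSup_of_finite
    have hmemF : ∀ t i j, LinearMap.toMatrix b b (f t).toLinearMap i j ∈ F := fun t i j =>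
      (le_iSup (fun p : Fin _ × Fin _ => E p.1 p.2) (i, j)) (hmem i j t)
    refine ⟨_, b, F.toSubring, Or.inr (Or.inr ⟨F, hF, RingEquiv.refl _, IsHomeomorph.id⟩),
      continuous_matrix hcont, fun t i j => ⟨hmemF t i j, ?_⟩⟩
    set M := LinearMap.toMatrix b b (f t).toLinearMap with hM
    set M' := LinearMap.toMatrix b b (f t).symm.toLinearMap with hM'
    have h1 : M' * M = 1 := by
      rw [hM, hM', ← LinearMap.toMatrix_comp]
      simp
    -- Since `F` is a field, the inverse can be computed over `F`, so its entries lie in `F` as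
    -- well.
    let N : Matrix _ _ F := Matrix.of fun i j => ⟨M i j, hmemF t i j⟩
    have hN : F.val.toRingHom.mapMatrix N = M := rfl
    have hdet : IsUnit N.det := by
      have h2 : (N.det : PadicAlgCl ℓ) = M.det := by
        rw [← hN]
        exact F.val.toRingHom.map_det N
      have h3 : M.det ≠ 0 := fun h0 => by
        have := congrArg Matrix.det h1
        rw [Matrix.det_mul, h0, mul_zero, Matrix.det_one] at this
        exact zero_ne_one this
      refine IsUnit.mk0 _ fun h0 => h3 ?_
      rw [← h2, h0]
      rfl
    have h4 : M' = F.val.toRingHom.mapMatrix N⁻¹ := by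
      have h5 := congrArg F.val.toRingHom.mapMatrix (N.mul_nonsing_inv hdet)
      rw [map_mul, map_one, hN] at h5
      calc M' = M' * (M * F.val.toRingHom.mapMatrix N⁻¹) := by rw [h5, mul_one]
        _ = _ := by rw [← mul_assoc, h1, one_mul]
    rw [h4]
    exact (N⁻¹ i j).2

end Admissible

/-! ### Representations on arbitrary finite-dimensional spaces and their classes -/

section FinRep

variable {ℓ : ℕ} [Fact ℓ.Prime] {G : Type*} [Group G] [TopologicalSpace G] {μ : Multiplier ℓ G}
variable {V : Type*} [AddCommGroup V] [Module (PadicAlgCl ℓ) V]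

/-- The family `ρ` defines a `C`-admissible representation of `(G, μ)` with finite projective
image. -/
structure IsFinRep (μ : Multiplier ℓ G) (ρ : G → Module.End (PadicAlgCl ℓ) V) : Prop where
  one : ρ 1 = 1
  mul : ∀ x y v, ρ x (ρ y v) = (μ.toFun x y : PadicAlgCl ℓ) • ρ (x * y) v
  admissible : ∀ (φ : V →ₗ[PadicAlgCl ℓ] PadicAlgCl ℓ) (v : V),
    IsAdmissibleFun fun g => φ (ρ g v)
  finite : ∃ F : Set G, F.Finite ∧ ∀ g, ∃ h ∈ F, ∃ c : PadicAlgCl ℓ, ∀ v, ρ g v = c • ρ h v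

namespace IsFinRep

variable {ρ : G → Module.End (PadicAlgCl ℓ) V}

theorem isProjRep (h : IsFinRep μ ρ) : IsProjRep ρ :=
  ⟨h.one, fun x y => ⟨_, (μ.toFun x y).ne_zero, h.mul x y⟩⟩

theorem restrict (h : IsFinRep μ ρ) {A : Submodule (PadicAlgCl ℓ) V}
    (hA : ∀ g, A ≤ A.comap (ρ g)) : IsFinRep μ fun g => (ρ g).restrict (hA g) where
  one := by
    ext v
    simp [h.one]
  mul x y v := Subtype.ext (h.mul x y v)
  admissible φ v := by
    obtain ⟨ψ, rfl⟩ := φ.exists_extend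
    exact h.admissible ψ v
  finite := by
    obtain ⟨F, hF, hc⟩ := h.finite
    refine ⟨F, hF, fun g => ?_⟩
    obtain ⟨x, hx, c, hxc⟩ := hc g
    exact ⟨x, hx, c, fun v => Subtype.ext (hxc v)⟩

theorem conj (h : IsFinRep μ ρ) {V' : Type*} [AddCommGroup V'] [Module (PadicAlgCl ℓ) V']
    (e : V ≃ₗ[PadicAlgCl ℓ] V') : IsFinRep μ fun g => e.conj (ρ g) where
  one := by
    ext v
    simp [h.one]
  mul x y v := by simp [LinearEquiv.conj_apply, h.mul]
  admissible φ v := h.admissible (φ ∘ₗ e.toLinearMap) (e.symm v)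
  finite := by
    obtain ⟨F, hF, hc⟩ := h.finite
    refine ⟨F, hF, fun g => ?_⟩
    obtain ⟨x, hx, c, hxc⟩ := hc g
    exact ⟨x, hx, c, fun v => by simp [LinearEquiv.conj_apply, hxc]⟩

variable [FiniteDimensional (PadicAlgCl ℓ) V]

/-- The automorphisms underlying a representation. -/
noncomputable def equiv (h : IsFinRep μ ρ) (g : G) : V ≃ₗ[PadicAlgCl ℓ] V :=
  LinearEquiv.ofInjectiveEndo (ρ g) (h.isProjRep.injective g)

theorem equiv_apply (h : IsFinRep μ ρ) (g : G) (v : V) : h.equiv g v = ρ g v := rfl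

/-- The bundled admissible representation. -/
noncomputable def toAdmissibleRep (h : IsFinRep μ ρ) : AdmissibleRep μ V where
  ρ := h.equiv
  admissible := isAdmissibleAutMap_iff.2 h.admissible
  twisted := h.mul

theorem hasFiniteProjectiveImage (h : IsFinRep μ ρ) :
    h.toAdmissibleRep.HasFiniteProjectiveImage := by
  obtain ⟨F, hF, hc⟩ := h.finite
  choose x hx c hxc using hc
  have key : ∀ g, (QuotientGroup.mk (h.equiv g) :
      (V ≃ₗ[PadicAlgCl ℓ] V) ⧸ homotheties ℓ V) = QuotientGroup.mk (h.equiv (x g)) := by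
    intro g
    rcases subsingleton_or_nontrivial V with _ | _
    · congr 1
      ext v
      exact Subsingleton.elim _ _
    have hc0 : c g ≠ 0 := by
      intro h0
      obtain ⟨v, hv⟩ := exists_ne (0 : V)
      refine hv (h.isProjRep.injective g ?_)
      rw [hxc, h0, zero_smul, map_zero]
    refine QuotientGroup.eq.2 ⟨(Units.mk0 (c g) hc0)⁻¹, ?_⟩
    rw [eq_inv_mul_iff_mul_eq]
    ext v
    have h1 : h.equiv g (((c g)⁻¹ : PadicAlgCl ℓ) • v) = h.equiv (x g) v := by
      rw [map_smul, equiv_apply, equiv_apply, hxc, inv_smul_smul₀ hc0]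
    exact h1
  refine (hF.image fun y => (QuotientGroup.mk (h.equiv y) :
    (V ≃ₗ[PadicAlgCl ℓ] V) ⧸ homotheties ℓ V)).subset ?_
  rintro _ ⟨g, rfl⟩
  exact ⟨x g, hx g, (key g).symm⟩

/-- The representation transported to some `Cⁿ`. -/
noncomputable def toFinRep (h : IsFinRep μ ρ) : FinRep μ where
  n := Module.finrank (PadicAlgCl ℓ) V
  rep := (h.conj (Module.finBasis (PadicAlgCl ℓ) V).equivFun).toAdmissibleRep
  fin := (h.conj (Module.finBasis (PadicAlgCl ℓ) V).equivFun).hasFiniteProjectiveImage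

/-- The coordinates identifying a representation with its transport to `Cⁿ`. -/
noncomputable def toFinRepEquiv (h : IsFinRep μ ρ) :
    V ≃ₗ[PadicAlgCl ℓ] (Fin h.toFinRep.n → PadicAlgCl ℓ) :=
  (Module.finBasis (PadicAlgCl ℓ) V).equivFun

theorem toFinRepEquiv_apply (h : IsFinRep μ ρ) (g : G) (v : V) :
    h.toFinRepEquiv (ρ g v) = h.toFinRep.rep.ρ g (h.toFinRepEquiv v) := by
  change _ = (Module.finBasis (PadicAlgCl ℓ) V).equivFun.conj (ρ g)
    ((Module.finBasis (PadicAlgCl ℓ) V).equivFun v)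
  rw [LinearEquiv.conj_apply_apply, LinearEquiv.symm_apply_apply]
  rfl

/-- The class of a representation in the Grothendieck group. -/
noncomputable def cls (h : IsFinRep μ ρ) : K0fin μ := h.toFinRep.cls

theorem _root_.TwistedBrauer.FinRep.IsExtension.cls_eq {V' V V'' : FinRep μ}
    (h : FinRep.IsExtension V' V V'') : V.cls = V'.cls + V''.cls := by
  refine (QuotientAddGroup.eq.2 ?_)
  rw [neg_add_eq_sub]
  exact AddSubgroup.subset_closure ⟨V', V, V'', h, rfl⟩

theorem cls_eq_add {M N P : Type*} [AddCommGroup M] [Module (PadicAlgCl ℓ) M]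
    [FiniteDimensional (PadicAlgCl ℓ) M] [AddCommGroup N] [Module (PadicAlgCl ℓ) N]
    [FiniteDimensional (PadicAlgCl ℓ) N] [AddCommGroup P] [Module (PadicAlgCl ℓ) P]
    [FiniteDimensional (PadicAlgCl ℓ) P] {ρM : G → Module.End (PadicAlgCl ℓ) M}
    {ρN : G → Module.End (PadicAlgCl ℓ) N} {ρP : G → Module.End (PadicAlgCl ℓ) P}
    (hM : IsFinRep μ ρM) (hN : IsFinRep μ ρN) (hP : IsFinRep μ ρP)
    {i : M →ₗ[PadicAlgCl ℓ] N} {p : N →ₗ[PadicAlgCl ℓ] P}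
    (h : IsShortExact ρM ρN ρP i p) : hN.cls = hM.cls + hP.cls := by
  refine FinRep.IsExtension.cls_eq ⟨hN.toFinRepEquiv.toLinearMap ∘ₗ i ∘ₗ
    hM.toFinRepEquiv.symm.toLinearMap, hP.toFinRepEquiv.toLinearMap ∘ₗ p ∘ₗ
    hN.toFinRepEquiv.symm.toLinearMap, ?_, ?_, ?_, ?_, ?_⟩
  · exact hN.toFinRepEquiv.injective.comp (h.injective.comp hM.toFinRepEquiv.symm.injective)
  · exact hP.toFinRepEquiv.surjective.comp (h.surjective.comp hN.toFinRepEquiv.symm.surjective)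
  · ext x
    have h1 := SetLike.ext_iff.1 h.exact (hN.toFinRepEquiv.symm x)
    simp only [LinearMap.mem_range, LinearMap.mem_ker, LinearMap.comp_apply,
      LinearEquiv.coe_coe, LinearEquiv.map_eq_zero_iff] at h1 ⊢
    rw [← h1]
    constructor
    · rintro ⟨y, hy⟩
      exact ⟨hM.toFinRepEquiv.symm y, by rw [← hy, LinearEquiv.symm_apply_apply]⟩
    · rintro ⟨y, hy⟩
      exact ⟨hM.toFinRepEquiv y, by
        rw [LinearEquiv.symm_apply_apply, hy, LinearEquiv.apply_symm_apply]⟩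
  · intro g v
    obtain ⟨v, rfl⟩ := hM.toFinRepEquiv.surjective v
    simp only [LinearMap.comp_apply, LinearEquiv.coe_coe, ← toFinRepEquiv_apply,
      LinearEquiv.symm_apply_apply, h.map_left]
  · intro g v
    obtain ⟨v, rfl⟩ := hN.toFinRepEquiv.surjective v
    simp only [LinearMap.comp_apply, LinearEquiv.coe_coe, ← toFinRepEquiv_apply,
      LinearEquiv.symm_apply_apply, h.map_right]

theorem cls_eq_zero [Subsingleton V] (h : IsFinRep μ ρ) : h.cls = 0 := by
  have := cls_eq_add h h h (i := LinearMap.id) (p := LinearMap.id)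
    ⟨fun _ _ h => h, fun x => ⟨x, rfl⟩, Subsingleton.elim _ _, fun _ _ => rfl, fun _ _ => rfl⟩
  exact left_eq_add.1 this

/-- The zero representation serves as the quotient in the exact sequence attached to an isomorphism.
-/
theorem bot (μ : Multiplier ℓ G) :
    IsFinRep μ fun _ : G => (1 : Module.End (PadicAlgCl ℓ) PUnit) where
  one := rfl
  mul _ _ _ := rfl
  admissible φ v := IsAdmissibleFun.const (φ v)
  finite := ⟨{1}, Set.finite_singleton 1, fun _ => ⟨1, rfl, 1, fun _ => rfl⟩⟩

theorem _root_.TwistedBrauer.FinRep.cls_eq_of_equiv {W W' : FinRep μ}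
    (e : (Fin W.n → PadicAlgCl ℓ) ≃ₗ[PadicAlgCl ℓ] (Fin W'.n → PadicAlgCl ℓ))
    (he : ∀ g v, e (W.rep.ρ g v) = W'.rep.ρ g (e v)) : W.cls = W'.cls := by
  have h0 : (bot μ).toFinRep.cls = 0 := (bot μ).cls_eq_zero
  have : Subsingleton (Fin (bot μ).toFinRep.n → PadicAlgCl ℓ) :=
    (bot μ).toFinRepEquiv.symm.toEquiv.subsingleton
  have h : FinRep.IsExtension W W' (bot μ).toFinRep :=
    ⟨e.toLinearMap, 0, e.injective, fun x => ⟨0, Subsingleton.elim _ _⟩, by simp, he,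
      fun _ _ => Subsingleton.elim _ _⟩
  rw [h.cls_eq, h0, add_zero]

end IsFinRep

/-- The endomorphisms underlying a member of `FinRep μ`. -/
def FinRep.toEnd (W : FinRep μ) (g : G) : Module.End (PadicAlgCl ℓ) (Fin W.n → PadicAlgCl ℓ) :=
  (W.rep.ρ g).toLinearMap

theorem FinRep.isFinRep (W : FinRep μ) : IsFinRep μ W.toEnd where
  one := by
    refine LinearMap.ext fun v => ?_
    -- With μ(1,1) = 1 this says that `ρ 1` is idempotent; being injective, it is the identity.
    have h := W.rep.twisted 1 1 v
    rw [μ.one_one, mul_one, Units.val_one, one_smul] at h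
    exact (W.rep.ρ 1).injective h
  mul := W.rep.twisted
  admissible := isAdmissibleAutMap_iff.1 W.rep.admissible
  finite := by
    have hfin := W.fin
    set q := fun g : G => (QuotientGroup.mk (W.rep.ρ g) :
      ((Fin W.n → PadicAlgCl ℓ) ≃ₗ[PadicAlgCl ℓ] (Fin W.n → PadicAlgCl ℓ)) ⧸
        homotheties ℓ (Fin W.n → PadicAlgCl ℓ)) with hq
    have : Finite (Set.range q) := hfin
    let s : Set.range q → G := fun y => y.2.choose
    have hs : ∀ y : Set.range q, q (s y) = y := fun y => y.2.choose_spec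
    refine ⟨Set.range s, Set.finite_range s, fun g => ⟨s ⟨q g, g, rfl⟩, ⟨_, rfl⟩, ?_⟩⟩
    obtain ⟨c, hc⟩ := QuotientGroup.eq.1 (hs ⟨q g, g, rfl⟩)
    refine ⟨c, fun v => ?_⟩
    rw [eq_inv_mul_iff_mul_eq] at hc
    have h1 := LinearEquiv.congr_fun hc v
    exact h1.symm.trans ((W.rep.ρ _).map_smul (c : PadicAlgCl ℓ) v)

theorem FinRep.cls_isFinRep (W : FinRep μ) : W.isFinRep.cls = W.cls :=
  (FinRep.cls_eq_of_equiv W.isFinRep.toFinRepEquiv W.isFinRep.toFinRepEquiv_apply).symm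

end FinRep

/-! ### Monomial representations -/

section Induced

variable {ℓ : ℕ} [Fact ℓ.Prime] {G : Type*} [Group G] [TopologicalSpace G] {μ : Multiplier ℓ G}
variable {V : Type*} [AddCommGroup V] [Module (PadicAlgCl ℓ) V]
  {ρ : G → Module.End (PadicAlgCl ℓ) V}

namespace IsFinRep

/-- An element fixes `i` exactly when the coordinates of `ρ g (b i)` outside `i` vanish. These are
closed conditions, and a closed subgroup of finite index is open. -/
theorem isOpen_stabilizer [IsTopologicalGroup G] (h : IsFinRep μ ρ) {ι : Type*} [Finite ι]
    [MulAction G ι] (b : Module.Basis ι (PadicAlgCl ℓ) V)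
    (hb : ∀ g i, ∃ c : PadicAlgCl ℓ, ρ g (b i) = c • b (g • i)) (i : ι) :
    IsOpen (MulAction.stabilizer G i : Set G) ∧ (MulAction.stabilizer G i).FiniteIndex := by
  have hfin : (MulAction.stabilizer G i).FiniteIndex := by
    refine ⟨?_⟩
    rw [MulAction.index_stabilizer]
    exact ((Set.ncard_pos (Set.toFinite _)).2 (MulAction.nonempty_orbit i)).ne'
  refine ⟨?_, hfin⟩
  refine Subgroup.isOpen_of_isClosed_of_finiteIndex _ ?_
  have : (MulAction.stabilizer G i : Set G) =
      ⋂ j : {j // j ≠ i}, {g | b.coord j (ρ g (b i)) = 0} := by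
    ext g
    obtain ⟨c, hc⟩ := hb g i
    simp only [SetLike.mem_coe, MulAction.mem_stabilizer_iff, Set.mem_iInter, Set.mem_ofPred_eq]
    constructor
    · rintro hg ⟨j, hj⟩
      rw [hc, hg]
      simp [hj]
    · intro hg
      by_contra hgi
      have h1 := hg ⟨g • i, hgi⟩
      rw [hc] at h1
      have hc0 : c = 0 := by simpa using h1
      rw [hc0, zero_smul] at hc
      exact b.ne_zero i (h.isProjRep.injective g (hc.trans (map_zero _).symm))
  rw [this]
  exact isClosed_iInter fun j => isClosed_singleton.preimage (h.admissible _ _).1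

variable [FiniteDimensional (PadicAlgCl ℓ) V]

/-- A representation with a basis whose lines are transitively permuted is induced from a
one-dimensional representation. -/
theorem isInducedFromRankOne [IsTopologicalGroup G] (h : IsFinRep μ ρ) {ι : Type*} [Finite ι]
    [MulAction G ι] [MulAction.IsPretransitive G ι] (b : Module.Basis ι (PadicAlgCl ℓ) V)
    (hb : ∀ g i, ∃ c : PadicAlgCl ℓ, ρ g (b i) = c • b (g • i)) (i₀ : ι) :
    h.toFinRep.IsInducedFromRankOne := by
  obtain ⟨hopen, hfin⟩ := h.isOpen_stabilizer b hb i₀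
  choose χ hχ using hb
  choose t ht using fun i => MulAction.exists_smul_eq G i₀ i
  have hχ0 : ∀ g i, χ g i ≠ 0 := by
    intro g i h0
    have h1 := hχ g i
    rw [h0, zero_smul] at h1
    exact b.ne_zero i (h.isProjRep.injective g (h1.trans (map_zero _).symm))
  set H := MulAction.stabilizer G i₀ with hH
  have hχH : ∀ g : H, ρ g (b i₀) = χ g i₀ • b i₀ := fun g => by
    rw [hχ, MulAction.mem_stabilizer_iff.1 g.2]
  have hχ1 : χ ((1 : H) : G) i₀ = 1 := by
    have h1 := hχH 1
    rw [Subgroup.coe_one, h.one] at h1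
    exact (smul_left_injective _ (b.ne_zero i₀) (by simpa using h1)).symm
  have hr : IsFinRep (μ.restrict H) fun g : H =>
      (χ g i₀ • 1 : Module.End (PadicAlgCl ℓ) (PadicAlgCl ℓ)) :=
    { one := by rw [hχ1, one_smul]
      mul := fun x y v => by
        have h1 := h.mul x y (b i₀)
        rw [hχH, map_smul, hχH, ← Subgroup.coe_mul, hχH, smul_smul, smul_smul] at h1
        have h2 := smul_left_injective _ (b.ne_zero i₀) h1
        change χ x i₀ * (χ y i₀ * v) = μ.toFun x y * (χ (x * y : H) i₀ * v)
        rw [← mul_assoc, ← mul_assoc, ← h2, mul_comm (χ x i₀)]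
      admissible := fun φ v => by
        have h1 := ((h.admissible (b.coord i₀) (b i₀)).comp
          (continuous_subtype_val (p := (· ∈ H)))).mul (.const (φ v))
        have h2 : ∀ g : H, φ ((χ g i₀ • 1 : Module.End (PadicAlgCl ℓ) (PadicAlgCl ℓ)) v)
            = b.coord i₀ (ρ g (b i₀)) * φ v := fun g => by
          rw [hχH, LinearMap.smul_apply, map_smul, map_smul]
          simp
        simpa only [h2] using h1
      finite := ⟨{1}, Set.finite_singleton 1, fun g => ⟨1, rfl, χ g i₀, fun v => by
        rw [hχ1]
        simp⟩⟩ }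
  refine ⟨H, hopen, hfin, PadicAlgCl ℓ, inferInstance, inferInstance, hr.toAdmissibleRep,
    Module.finrank_self _, ?_⟩
  set r := hr.toAdmissibleRep with hrdef
  have hrρ : ∀ (g : H) (c : PadicAlgCl ℓ), r.ρ g c = χ g i₀ * c := fun _ _ => rfl
  -- The map from the induced space extends the inclusion of the line of `b i₀`, by Frobenius
  -- reciprocity.
  let Φ : (G →₀ PadicAlgCl ℓ) →ₗ[PadicAlgCl ℓ] V :=
    Finsupp.lsum (PadicAlgCl ℓ) fun g => LinearMap.toSpanSingleton (PadicAlgCl ℓ) V (ρ g (b i₀))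
  have hΦ : ∀ g c, Φ (Finsupp.single g c) = c • ρ g (b i₀) := fun g c => by simp [Φ]
  have hker : indRelations μ H r ≤ LinearMap.ker Φ := by
    refine Submodule.span_le.2 ?_
    rintro _ ⟨g, x, c, rfl⟩
    have h1 := h.mul g x (b i₀)
    rw [hχH, map_smul] at h1
    rw [SetLike.mem_coe, LinearMap.mem_ker, map_sub, map_smul, hΦ, hΦ, hrρ, smul_comm, ← h1,
      smul_smul, mul_comm, sub_self]
  let Φ' : Ind μ H r →ₗ[PadicAlgCl ℓ] V := (indRelations μ H r).liftQ Φ hker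
  let m := (indRelations μ H r).mkQ
  have hΦ' : ∀ x, Φ' (m x) = Φ x := fun _ => rfl
  -- The inverse is forced by `ρ (t i) (b i₀) = χ (t i) i₀ • b i`. It is onto since any `g` is `t i`
  -- times an element of `H`, where `i = g • i₀`.
  let Ψ : V →ₗ[PadicAlgCl ℓ] Ind μ H r :=
    b.constr (PadicAlgCl ℓ) fun i => (χ (t i) i₀)⁻¹ • m (Finsupp.single (t i) 1)
  have hΨ : ∀ i, Ψ (b i) = (χ (t i) i₀)⁻¹ • m (Finsupp.single (t i) 1) :=
    b.constr_basis (PadicAlgCl ℓ) _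
  have hΦΨ : ∀ v, Φ' (Ψ v) = v := by
    refine LinearMap.congr_fun (f := Φ' ∘ₗ Ψ) (g := LinearMap.id) (b.ext fun i => ?_)
    rw [LinearMap.comp_apply, hΨ, map_smul, hΦ', hΦ, one_smul, hχ, ht,
      inv_smul_smul₀ (hχ0 _ _), LinearMap.id_apply]
  have hsurj : Function.Surjective Ψ := by
    rw [← LinearMap.range_eq_top, eq_top_iff]
    rintro x -
    obtain ⟨f, rfl⟩ := (indRelations μ H r).mkQ_surjective x
    change m f ∈ _
    induction f using Finsupp.induction_linear with
    | zero => rw [map_zero]; exact Submodule.zero_mem _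
    | add f f' hf hf' => rw [map_add]; exact Submodule.add_mem _ hf hf'
    | single g c =>
      set i := g • i₀ with hi
      have hx : (t i)⁻¹ * g ∈ H := by
        rw [MulAction.mem_stabilizer_iff, mul_smul, ← hi, inv_smul_eq_iff, ht]
      have h1 : m ((μ.toFun (t i) ((t i)⁻¹ * g) : PadicAlgCl ℓ) • Finsupp.single g c
          - Finsupp.single (t i) (χ ((t i)⁻¹ * g) i₀ * c)) = 0 := by
        refine (Submodule.Quotient.mk_eq_zero _).2 (Submodule.subset_span
          ⟨t i, ⟨(t i)⁻¹ * g, hx⟩, c, ?_⟩)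
        rw [hrρ, mul_inv_cancel_left]
      rw [map_sub, map_smul, sub_eq_zero, ← eq_inv_smul_iff₀ (Units.ne_zero _)] at h1
      rw [h1]
      refine Submodule.smul_mem _ _ ⟨(χ ((t i)⁻¹ * g) i₀ * c * χ (t i) i₀) • b i, ?_⟩
      rw [map_smul, hΨ, smul_smul, mul_assoc, mul_inv_cancel₀ (hχ0 _ _), mul_one, ← map_smul,
        Finsupp.smul_single, smul_eq_mul, mul_one]
  let e : V ≃ₗ[PadicAlgCl ℓ] Ind μ H r := LinearEquiv.ofBijective Ψ
    ⟨Function.LeftInverse.injective hΦΨ, hsurj⟩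
  have hequiv : ∀ g x, Φ' (indAct μ H r g x) = ρ g (Φ' x) := by
    intro g x
    obtain ⟨f, rfl⟩ := (indRelations μ H r).mkQ_surjective x
    change Φ (leftMul μ _ g f) = ρ g (Φ f)
    induction f using Finsupp.induction_linear with
    | zero => simp
    | add f f' hf hf' => simp only [map_add, hf, hf']
    | single y c => rw [leftMul_single, map_smul, hΦ, hΦ, map_smul, h.mul, smul_comm]
  refine ⟨h.toFinRepEquiv.symm.trans e, fun g w => ?_⟩
  obtain ⟨v, rfl⟩ := h.toFinRepEquiv.surjective w
  rw [← h.toFinRepEquiv_apply, LinearEquiv.trans_apply, LinearEquiv.trans_apply,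
    LinearEquiv.symm_apply_apply, LinearEquiv.symm_apply_apply]
  change Ψ (ρ g v) = indAct μ H r g (Ψ v)
  obtain ⟨w, hw⟩ := hsurj (indAct μ H r g (Ψ v))
  rw [← hw, ← hΦΨ w, hw, hequiv, hΦΨ]

theorem cls_eq_add_of_isCompl (h : IsFinRep μ ρ) {A B : Submodule (PadicAlgCl ℓ) V}
    (hAB : IsCompl A B) (hA : ∀ g, A ≤ A.comap (ρ g)) (hB : ∀ g, B ≤ B.comap (ρ g)) :
    h.cls = (h.restrict hA).cls + (h.restrict hB).cls := by
  refine cls_eq_add (i := A.subtype) (p := B.projectionOnto A hAB.symm) _ _ _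
    ⟨A.injective_subtype, Submodule.projectionOnto_surjective hAB.symm, ?_, fun _ _ => rfl,
      fun g v => ?_⟩
  · rw [Submodule.range_subtype, Submodule.ker_projectionOnto]
  · obtain ⟨a, b, ha, hb, rfl⟩ : ∃ a b, a ∈ A ∧ b ∈ B ∧ a + b = v := by
      obtain ⟨a, ha, b, hb, h⟩ := Submodule.mem_sup.1 (hAB.sup_eq_top ▸ Submodule.mem_top (x := v))
      exact ⟨a, b, ha, hb, h⟩
    have h1 : ∀ x ∈ A, B.projectionOnto A hAB.symm x = 0 := fun x hx =>
      (Submodule.projectionOnto_apply_eq_zero_iff hAB.symm).2 hx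
    simp only [map_add, h1 a ha, h1 _ (hA g ha), zero_add,
      Submodule.projectionOnto_apply_of_mem_left hAB.symm hb,
      Submodule.projectionOnto_apply_of_mem_left hAB.symm (hB g hb)]
    rfl

/-- The class of a monomial representation is a sum of classes of representations induced from
one-dimensional ones. -/
theorem cls_mem_of_basis [IsTopologicalGroup G] {S : AddSubgroup (K0fin μ)}
    (hS : ∀ W : FinRep μ, W.IsInducedFromRankOne → W.cls ∈ S) (h : IsFinRep μ ρ) {ι : Type*}
    [Finite ι] [MulAction G ι] (b : Module.Basis ι (PadicAlgCl ℓ) V)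
    (hb : ∀ g i, ∃ c : PadicAlgCl ℓ, ρ g (b i) = c • b (g • i)) : h.cls ∈ S := by
  induction hn : Nat.card ι using Nat.strong_induction_on generalizing ι V with
  | _ n ih =>
  rcases isEmpty_or_nonempty ι with _ | ⟨⟨i₀⟩⟩
  · have : Subsingleton V := b.repr.toEquiv.subsingleton
    rw [h.cls_eq_zero]
    exact S.zero_mem
  -- The orbit of `i₀` spans an induced summand; the complementary basis vectors are fewer and fall
  -- to induction.
  let O : SubMulAction G ι := ⟨MulAction.orbit G i₀, fun g i hi =>
    MulAction.mem_orbit_of_mem_orbit g hi⟩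
  let O' : SubMulAction G ι := ⟨(MulAction.orbit G i₀)ᶜ, fun g i hi hgi => hi (by
    simpa using MulAction.mem_orbit_of_mem_orbit g⁻¹ hgi)⟩
  let A (P : SubMulAction G ι) : Submodule (PadicAlgCl ℓ) V :=
    Submodule.span (PadicAlgCl ℓ) (Set.range fun i : P => b i)
  let bP (P : SubMulAction G ι) : Module.Basis P (PadicAlgCl ℓ) (A P) :=
    Module.Basis.span (b.linearIndependent.comp _ (Subtype.val_injective (p := (· ∈ P))))
  have hbP : ∀ P i, (bP P i : V) = b i := fun P i => congrArg Subtype.val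
    (Module.Basis.span_apply (b.linearIndependent.comp _ Subtype.val_injective) i)
  have hA : ∀ (P : SubMulAction G ι) g, A P ≤ (A P).comap (ρ g) := by
    intro P g
    refine Submodule.span_le.2 ?_
    rintro _ ⟨i, rfl⟩
    obtain ⟨c, hc⟩ := hb g i
    change ρ g (b i) ∈ A P
    rw [hc]
    exact (A P).smul_mem c (Submodule.subset_span ⟨⟨g • i, P.smul_mem g i.2⟩, rfl⟩)
  have hbA : ∀ (P : SubMulAction G ι) g i, ∃ c : PadicAlgCl ℓ,
      (ρ g).restrict (hA P g) (bP P i) = c • bP P (g • i) := by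
    intro P g i
    obtain ⟨c, hc⟩ := hb g i
    refine ⟨c, Subtype.ext ?_⟩
    rw [LinearMap.coe_restrict_apply, hbP, hc, Submodule.coe_smul, hbP]
    rfl
  have hcompl : IsCompl (A O) (A O') := by
    have hset : ∀ P : SubMulAction G ι, (Set.range fun i : P => b i) = b '' (P : Set ι) :=
      fun P => (Set.image_eq_range b P).symm
    have := b.linearIndependent.isCompl_span_image b.span_eq
      (isCompl_compl (x := (O : Set ι)))
    simp only [A, hset]
    exact this
  rw [h.cls_eq_add_of_isCompl hcompl (hA O) (hA O')]
  refine S.add_mem (hS _ ?_) (ih (Nat.card O') ?_ _ (bP O') (hbA O') rfl)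
  · have : MulAction.IsPretransitive G O := by
      refine ⟨?_⟩
      rintro ⟨_, x, rfl⟩ ⟨_, y, rfl⟩
      exact ⟨y * x⁻¹, Subtype.ext (by simp [mul_smul])⟩
    exact (h.restrict (hA O)).isInducedFromRankOne (bP O) (hbA O) ⟨i₀, MulAction.mem_orbit_self i₀⟩
  · rw [← hn]
    refine Finite.card_subtype_lt (x := i₀) fun h => h (MulAction.mem_orbit_self i₀)

/-- The lines spanned by the basis vectors are independent, so their permutation is a genuine action
of `G` on the indices. -/
theorem cls_mem_of_isMonomialOn [IsTopologicalGroup G] {S : AddSubgroup (K0fin μ)}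
    (hS : ∀ W : FinRep μ, W.IsInducedFromRankOne → W.cls ∈ S) (h : IsFinRep μ ρ)
    (hmon : IsMonomialOn ρ ⊤ ⊤) : h.cls ∈ S := by
  obtain ⟨n, v, hv, hspan, hperm⟩ := hmon
  let b := Module.Basis.mk hv hspan.ge
  have hbv : ∀ i, b i = v i := fun i => Module.Basis.mk_apply _ _ i
  have hne : ∀ i, Submodule.span (PadicAlgCl ℓ) {v i} ≠ ⊥ := fun i =>
    fun h0 => hv.ne_zero i (Submodule.span_singleton_eq_bot.1 h0)
  obtain ⟨_, hact⟩ := h.isProjRep.exists_mulAction (S := ⊤) hv.iSupIndep_span_singleton hne (by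
    intro s hs i
    obtain ⟨j, c, hc⟩ := hperm s hs i
    refine ⟨j, fun w hw => ?_⟩
    obtain ⟨a, rfl⟩ := Submodule.mem_span_singleton.1 hw
    rw [map_smul, hc]
    exact Submodule.smul_mem _ _ (Submodule.smul_mem _ _ (Submodule.mem_span_singleton_self _)))
  let _ : MulAction G (Fin n) := MulAction.compHom (Fin n) Subgroup.topEquiv.symm.toMonoidHom
  refine h.cls_mem_of_basis hS b fun g i => ?_
  rw [hbv, hbv]
  obtain ⟨c, hc⟩ := Submodule.mem_span_singleton.1
    (hact ⟨g, trivial⟩ i (v i) (Submodule.mem_span_singleton_self _))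
  exact ⟨c, hc.symm⟩

end IsFinRep

end Induced

/-! ### Tensor products with representations of a finite quotient -/

section TensorRep

variable {k : Type*} [Field k] {G : Type*} [Group G] {V : Type*} [AddCommGroup V] [Module k V]

/-- The tensor product of a projective representation of `G` with a representation of a quotient of
`G`. -/
noncomputable abbrev tensorRep (ρ : G → Module.End k V)
    {N : Subgroup G} [N.Normal] {M : Type*} [AddCommGroup M] [Module k M]
    (σ : Representation k (G ⧸ N) M) (g : G) :
    Module.End k (V ⊗[k] M) :=
  TensorProduct.map (ρ g) (σ (QuotientGroup.mk g))

/-- Flatness over a field; this makes the class of `V ⊗ M` additive in `M`. -/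
theorem IsShortExact.lTensor {N : Subgroup G} [N.Normal] {M M' M'' : Type*}
    [AddCommGroup M] [Module k M] [AddCommGroup M'] [Module k M']
    [AddCommGroup M''] [Module k M'']
    {σ : Representation k (G ⧸ N) M} {σ' : Representation k (G ⧸ N) M'}
    {σ'' : Representation k (G ⧸ N) M''} {i : M →ₗ[k] M'}
    {p : M' →ₗ[k] M''} (h : IsShortExact σ σ' σ'' i p)
    (ρ : G → Module.End k V) :
    IsShortExact (tensorRep ρ σ) (tensorRep ρ σ') (tensorRep ρ σ'') (i.lTensor V)
      (p.lTensor V) where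
  injective := Module.Flat.lTensor_preserves_injective_linearMap i h.injective
  surjective := LinearMap.lTensor_surjective V h.surjective
  exact := ((LinearMap.exact_iff.1
    (lTensor_exact V (LinearMap.exact_iff.2 h.exact.symm) h.surjective))).symm
  map_left g v := by
    induction v with
    | zero => simp
    | add v w hv hw => simp only [map_add, hv, hw]
    | tmul v m => simp [h.map_left]
  map_right g v := by
    induction v with
    | zero => simp
    | add v w hv hw => simp only [map_add, hv, hw]
    | tmul v m => simp [h.map_right]

theorem isShortExact_prod {Q M P : Type*} [Group Q] [AddCommGroup M] [Module k M]
    [AddCommGroup P] [Module k P] (σ : Representation k Q M) (τ : Representation k Q P) :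
    IsShortExact σ (σ.prod τ) τ (LinearMap.inl k M P) (LinearMap.snd k M P) where
  injective := LinearMap.inl_injective
  surjective := LinearMap.snd_surjective
  exact := LinearMap.range_inl k M P
  map_left _ _ := by simp
  map_right _ _ := by simp

end TensorRep

section Tensor

variable {ℓ : ℕ} [Fact ℓ.Prime] {G : Type*} [Group G] [TopologicalSpace G] {μ : Multiplier ℓ G}
variable {V : Type*} [AddCommGroup V] [Module (PadicAlgCl ℓ) V]
variable {ρ : G → Module.End (PadicAlgCl ℓ) V}

namespace IsFinRep

/-- Elements with proportional operators lie in the same coset. -/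
theorem finite_quotient_scalarOn (h : IsFinRep μ ρ) : Finite (G ⧸ h.isProjRep.scalarOn ⊤) := by
  obtain ⟨F, hF, hc⟩ := h.finite
  have := hF.to_subtype
  refine Finite.of_surjective (fun x : F => (QuotientGroup.mk (x : G) :
    G ⧸ h.isProjRep.scalarOn ⊤)) fun y => ?_
  obtain ⟨g, rfl⟩ := QuotientGroup.mk_surjective y
  obtain ⟨x, hx, c, hxc⟩ := hc g
  refine ⟨⟨x, hx⟩, QuotientGroup.eq.2 ?_⟩
  refine ⟨(μ.toFun x⁻¹ g : PadicAlgCl ℓ)⁻¹ * (c * μ.toFun x⁻¹ x), fun v _ => ?_⟩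
  rw [mul_smul, eq_inv_smul_iff₀ (Units.ne_zero _), ← h.mul, hxc, map_smul, h.mul,
    inv_mul_cancel, h.one, Module.End.one_apply, mul_smul]

/-- Being a scalar matrix is a closed condition on matrix coefficients, and the subgroup has finite
index. -/
theorem isOpen_scalarOn [IsTopologicalGroup G] [FiniteDimensional (PadicAlgCl ℓ) V]
    (h : IsFinRep μ ρ) : IsOpen (h.isProjRep.scalarOn ⊤ : Set G) := by
  have := h.finite_quotient_scalarOn
  have : (h.isProjRep.scalarOn ⊤).FiniteIndex := Subgroup.finiteIndex_of_finite_quotient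
  refine Subgroup.isOpen_of_isClosed_of_finiteIndex _ ?_
  let b := Module.finBasis (PadicAlgCl ℓ) V
  have : (h.isProjRep.scalarOn ⊤ : Set G) =
      (⋂ (i) (j) (_ : i ≠ j), {g | b.coord i (ρ g (b j)) = 0}) ∩
        ⋂ (i) (j), {g | b.coord i (ρ g (b i)) = b.coord j (ρ g (b j))} := by
    ext g
    simp only [SetLike.mem_coe, Set.mem_inter_iff, Set.mem_iInter, Set.mem_ofPred_eq]
    constructor
    · rintro ⟨c, hc⟩
      have hc' : ∀ v, ρ g v = c • v := fun v => hc v trivial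
      refine ⟨fun i j hij => ?_, fun i j => ?_⟩
      · simp [hc', hij]
      · simp [hc']
    · rintro ⟨h1, h2⟩
      rcases isEmpty_or_nonempty (Fin (Module.finrank (PadicAlgCl ℓ) V)) with he | ⟨⟨i₀⟩⟩
      · have : Subsingleton V := b.repr.toEquiv.subsingleton
        exact ⟨1, fun v _ => Subsingleton.elim _ _⟩
      refine ⟨b.coord i₀ (ρ g (b i₀)), fun v _ => ?_⟩
      have h3 : ρ g = b.coord i₀ (ρ g (b i₀)) • 1 := by
        refine b.ext fun j => b.ext_elem fun i => ?_
        by_cases hij : i = j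
        · subst hij
          have := h2 i i₀
          simpa using this
        · have := h1 i j hij
          have hji : ¬ j = i := fun h => hij h.symm
          simpa [hij, hji] using this
      conv_lhs => rw [h3]
      rfl
  rw [this]
  refine IsClosed.inter ?_ ?_
  · exact isClosed_iInter fun i => isClosed_iInter fun j => isClosed_iInter fun _ =>
      isClosed_singleton.preimage (h.admissible _ _).1
  · exact isClosed_iInter fun i => isClosed_iInter fun j =>
      isClosed_eq (h.admissible _ _).1 (h.admissible _ _).1

/-- The multiplier is unchanged because `σ` is an honest representation. Its coefficients factor
through a finite discrete group, hence are admissible, and elements congruent modulo `N` act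
proportionally. -/
theorem tensor [IsTopologicalGroup G] (h : IsFinRep μ ρ) {N : Subgroup G} [N.Normal]
    [Finite (G ⧸ N)] (hopen : IsOpen (N : Set G)) (hN : N ≤ h.isProjRep.scalarOn ⊤)
    {M : Type*} [AddCommGroup M] [Module (PadicAlgCl ℓ) M] [FiniteDimensional (PadicAlgCl ℓ) M]
    (σ : Representation (PadicAlgCl ℓ) (G ⧸ N) M) : IsFinRep μ (tensorRep ρ σ) where
  one := by
    rw [tensorRep, h.one, QuotientGroup.mk_one, map_one]
    exact TensorProduct.map_one
  mul x y v := by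
    induction v with
    | zero => simp
    | add v w hv hw => simp only [map_add, smul_add, hv, hw]
    | tmul v m =>
      simp only [TensorProduct.map_tmul, h.mul, QuotientGroup.mk_mul, map_mul,
        Module.End.mul_apply, TensorProduct.smul_tmul']
  admissible φ v := by
    induction v with
    | zero => simpa using .const 0
    | add v w hv hw => simpa only [map_add] using hv.add hw
    | tmul v m =>
      have : DiscreteTopology (G ⧸ N) := QuotientGroup.discreteTopology hopen
      let b := Module.finBasis (PadicAlgCl ℓ) M
      have h1 : ∀ g, φ (tensorRep ρ σ g (v ⊗ₜ m)) = ∑ i, b.repr (σ (QuotientGroup.mk g) m) i *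
          (φ ∘ₗ (TensorProduct.mk (PadicAlgCl ℓ) V M).flip (b i)) (ρ g v) := by
        intro g
        rw [tensorRep, TensorProduct.map_tmul]
        conv_lhs => rw [← b.sum_repr (σ (QuotientGroup.mk g) m)]
        rw [TensorProduct.tmul_sum, map_sum]
        refine Finset.sum_congr rfl fun i _ => ?_
        rw [TensorProduct.tmul_smul, map_smul]
        rfl
      simp_rw [h1]
      refine IsAdmissibleFun.sum _ fun i _ => IsAdmissibleFun.mul ?_ (h.admissible _ _)
      exact (IsAdmissibleFun.of_discrete fun q : G ⧸ N => b.repr (σ q m) i).comp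
        QuotientGroup.continuous_mk
  finite := by
    refine ⟨Set.range (Quotient.out : G ⧸ N → G), Set.finite_range _,
      fun g => ⟨_, ⟨QuotientGroup.mk g, rfl⟩, ?_⟩⟩
    set x := (Quotient.out (QuotientGroup.mk g : G ⧸ N)) with hx
    have hxg : (QuotientGroup.mk x : G ⧸ N) = QuotientGroup.mk g := QuotientGroup.out_eq' _
    obtain ⟨c, hc⟩ := hN (QuotientGroup.eq.1 hxg)
    refine ⟨(μ.toFun x (x⁻¹ * g) : PadicAlgCl ℓ)⁻¹ * c, fun w => ?_⟩
    have h1 : ρ g = ((μ.toFun x (x⁻¹ * g) : PadicAlgCl ℓ)⁻¹ * c) • ρ x := by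
      refine LinearMap.ext fun v => ?_
      have h2 := h.mul x (x⁻¹ * g) v
      rw [hc v trivial, map_smul, mul_inv_cancel_left] at h2
      rw [LinearMap.smul_apply, mul_smul, h2, inv_smul_smul₀ (Units.ne_zero _)]
    rw [tensorRep, tensorRep, hxg, h1, TensorProduct.map_smul_left]
    rfl

variable [FiniteDimensional (PadicAlgCl ℓ) V]

theorem cls_eq_of_equiv (h : IsFinRep μ ρ) {V' : Type*} [AddCommGroup V']
    [Module (PadicAlgCl ℓ) V'] [FiniteDimensional (PadicAlgCl ℓ) V']
    {ρ' : G → Module.End (PadicAlgCl ℓ) V'} (h' : IsFinRep μ ρ') (e : V ≃ₗ[PadicAlgCl ℓ] V')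
    (he : ∀ g v, e (ρ g v) = ρ' g (e v)) : h.cls = h'.cls := by
  have := cls_eq_add h h' (bot μ) (i := e.toLinearMap) (p := 0)
    ⟨e.injective, fun x => ⟨0, rfl⟩, by simp, he, fun _ _ => rfl⟩
  rw [this, (bot μ).cls_eq_zero, add_zero]

/-- The tensor product with a permutation representation with quasi-elementary stabilizers is
monomial. -/
theorem isMonomialOn_tensor_permRep {N : Subgroup G} [N.Normal] [Finite (G ⧸ N)]
    (h : IsFinRep μ ρ) (hN : N ≤ h.isProjRep.scalarOn ⊤) {X : Type*} [Finite X]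
    [MulAction (G ⧸ N) X] (hX : ∀ x : X, IsQuasiElementary (MulAction.stabilizer (G ⧸ N) x))
    (hT : IsFinRep μ (tensorRep ρ (permRep (PadicAlgCl ℓ) (G ⧸ N) X))) :
    IsMonomialOn (tensorRep ρ (permRep (PadicAlgCl ℓ) (G ⧸ N) X)) ⊤ ⊤ := by
  classical
  have := Fintype.ofFinite X
  let A : X → Submodule (PadicAlgCl ℓ) (V ⊗[PadicAlgCl ℓ] (X → PadicAlgCl ℓ)) := fun x =>
    LinearMap.range ((TensorProduct.mk (PadicAlgCl ℓ) V (X → PadicAlgCl ℓ)).flip (Pi.single x 1))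
  have hAmem : ∀ x v, v ⊗ₜ[PadicAlgCl ℓ] (Pi.single x 1 : X → PadicAlgCl ℓ) ∈ A x :=
    fun x v => ⟨v, rfl⟩
  have hAtop : ⨆ x, A x = ⊤ := by
    rw [eq_top_iff]
    rintro w -
    induction w with
    | zero => exact Submodule.zero_mem _
    | add v w hv hw => exact Submodule.add_mem _ hv hw
    | tmul v f =>
      rw [← Finset.univ_sum_single f, TensorProduct.tmul_sum]
      refine Submodule.sum_mem _ fun x _ => Submodule.mem_iSup_of_mem x ?_
      rw [show (Pi.single x (f x) : X → PadicAlgCl ℓ) = f x • Pi.single x 1 by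
        rw [← Pi.single_smul, smul_eq_mul, mul_one], TensorProduct.tmul_smul]
      exact Submodule.smul_mem _ _ (hAmem x v)
  have hAind : iSupIndep A := by
    intro x
    rw [Submodule.disjoint_def]
    rintro _ ⟨v, rfl⟩ hv
    let p : V ⊗[PadicAlgCl ℓ] (X → PadicAlgCl ℓ) →ₗ[PadicAlgCl ℓ] V :=
      (TensorProduct.rid (PadicAlgCl ℓ) V).toLinearMap ∘ₗ
        (LinearMap.proj x : (X → PadicAlgCl ℓ) →ₗ[PadicAlgCl ℓ] PadicAlgCl ℓ).lTensor V
    have hle : ⨆ (j) (_ : j ≠ x), A j ≤ LinearMap.ker p := by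
      refine iSup₂_le fun j hj => ?_
      rintro _ ⟨w, rfl⟩
      simp [p, hj.symm]
    have h1 : p (v ⊗ₜ Pi.single x 1) = 0 := hle hv
    have h2 : v = 0 := by simpa [p] using h1
    rw [h2, map_zero]
  let _ : MulAction (⊤ : Subgroup G) X :=
    MulAction.compHom X ((QuotientGroup.mk' N).comp (⊤ : Subgroup G).subtype)
  have hact : ∀ (s : (⊤ : Subgroup G)) (x : X), ∀ w ∈ A x,
      tensorRep ρ (permRep (PadicAlgCl ℓ) (G ⧸ N) X) s w ∈ A (s • x) := by
    rintro s x _ ⟨v, rfl⟩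
    rw [LinearMap.flip_apply, TensorProduct.mk_apply, TensorProduct.map_tmul, permRep_single]
    exact hAmem _ _
  rw [← hAtop]
  refine hT.isProjRep.isMonomialOn_iSup hAind hact fun x => ?_
  -- `N` acts by scalars on `V` and trivially on the permutation factor, and the stabilizer of `x`
  -- maps into its quasi-elementary stabilizer in `G ⧸ N`.
  refine hT.isProjRep.isMonomialOn_of_isQuasiElementary (QuotientGroup.mk' N) ?_ _ _ ?_ ?_
  · rw [QuotientGroup.ker_mk']
    intro n hn
    obtain ⟨c, hc⟩ := hN hn
    refine ⟨c, fun w _ => ?_⟩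
    have h1 : ρ n = c • 1 := LinearMap.ext fun v => hc v trivial
    rw [tensorRep, (QuotientGroup.eq_one_iff n).2 hn, map_one, h1, TensorProduct.map_smul_left]
    exact congrArg (c • ·) (LinearMap.congr_fun TensorProduct.map_one w)
  · rintro _ ⟨s, hs, rfl⟩ w hw
    have := hact s x w hw
    rwa [MulAction.mem_stabilizer_iff.1 hs] at this
  · refine (hX x).mono ?_
    rintro _ ⟨_, ⟨s, hs, rfl⟩, rfl⟩
    exact hs

end IsFinRep

end Tensor

end TwistedBrauer

/-! ### The induction theorem -/

theorem mainTheorem9 (ℓ : ℕ) [Fact ℓ.Prime] (G : Type*) [Group G] [TopologicalSpace G]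
    [IsTopologicalGroup G] (μ : TwistedBrauer.Multiplier ℓ G) :
    AddSubgroup.closure
      {x : TwistedBrauer.K0fin μ |
        ∃ W : TwistedBrauer.FinRep μ, W.IsInducedFromRankOne ∧ x = W.cls} = ⊤ := by
  open TwistedBrauer in
  set S := AddSubgroup.closure
      {x : K0fin μ | ∃ W : FinRep μ, W.IsInducedFromRankOne ∧ x = W.cls} with hSdef
  have hS : ∀ W : FinRep μ, W.IsInducedFromRankOne → W.cls ∈ S := fun W hW =>
    AddSubgroup.subset_closure ⟨W, hW, rfl⟩
  suffices hW : ∀ W : FinRep μ, W.cls ∈ S by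
    rw [eq_top_iff]
    rintro x -
    obtain ⟨x, rfl⟩ := QuotientAddGroup.mk_surjective x
    induction x using FreeAbelianGroup.induction_on with
    | zero => exact S.zero_mem
    | of W => exact hW W
    | neg W ih => exact S.neg_mem ih
    | add x y hx hy => exact S.add_mem hx hy
  intro W
  have h := W.isFinRep
  set N := h.isProjRep.scalarOn ⊤ with hN
  have hNn : N.Normal := h.isProjRep.normal_scalarOn_top
  have hfin : Finite (G ⧸ N) := h.finite_quotient_scalarOn
  have hT {M : Type _} [AddCommGroup M] [Module (PadicAlgCl ℓ) M]
      [FiniteDimensional (PadicAlgCl ℓ) M] (σ : Representation (PadicAlgCl ℓ) (G ⧸ N) M) :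
      IsFinRep μ (tensorRep W.toEnd σ) := h.tensor h.isOpen_scalarOn le_rfl σ
  obtain ⟨X, Y, _, _, hX, hY, sX, sY, hXY⟩ := isQuasiElementaryMark_one (Q := G ⧸ N)
  -- Functions on `PUnit` put the trivial line in the universe of the functions on `X` and `Y`.
  let σ₁ := Representation.trivial (PadicAlgCl ℓ) (G ⧸ N) (PUnit → PadicAlgCl ℓ)
  let σX := permRep (PadicAlgCl ℓ) (G ⧸ N) X
  let σY := permRep (PadicAlgCl ℓ) (G ⧸ N) Y
  have hadd := IsFinRep.cls_eq_add (hT σ₁) (hT (σ₁.prod σY)) (hT σY)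
    ((isShortExact_prod σ₁ σY).lTensor W.toEnd)
  -- Solomon's identity with the negative term moved across, so that both sides are characters of
  -- actual representations.
  have hchar : (σ₁.prod σY).character = σX.character := by
    ext g
    have h1 := (isShortExact_prod σ₁ σY).trace_eq g
    have h2 : LinearMap.trace (PadicAlgCl ℓ) _ (σ₁ g) = 1 := by
      simp [σ₁, Representation.trivial]
    have h3 := character_permRep (k := PadicAlgCl ℓ) (X := X) g
    have h4 := character_permRep (k := PadicAlgCl ℓ) (X := Y) g
    have h5 := congrArg (Int.cast : ℤ → PadicAlgCl ℓ) (hXY g)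
    rw [Representation.character, h1, h2, h3]
    change 1 + (permRep (PadicAlgCl ℓ) (G ⧸ N) Y).character g = _
    rw [h4]
    push_cast [Pi.one_apply] at h5
    rw [h5]
    ring
  have heq := eq_of_character_eq (fun M _ _ _ σ => (hT σ).cls)
    (fun M N P _ _ _ _ _ _ _ _ _ ρM ρN ρP i p hip =>
      IsFinRep.cls_eq_add (hT ρM) (hT ρN) (hT ρP) (hip.lTensor W.toEnd)) _ _ _ _ hchar
  have hone : W.cls = (hT σ₁).cls := by
    rw [← W.cls_isFinRep]
    refine h.cls_eq_of_equiv (hT σ₁) ((TensorProduct.rid (PadicAlgCl ℓ) _).symm.trans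
      (LinearEquiv.lTensor _ (LinearEquiv.funUnique PUnit (PadicAlgCl ℓ) _).symm)) fun g v => ?_
    simp [σ₁, Representation.trivial]
  have hXS : (hT σX).cls ∈ S := (hT σX).cls_mem_of_isMonomialOn hS
    (h.isMonomialOn_tensor_permRep le_rfl sX (hT σX))
  have hYS : (hT σY).cls ∈ S := (hT σY).cls_mem_of_isMonomialOn hS
    (h.isMonomialOn_tensor_permRep le_rfl sY (hT σY))
  rw [hone, eq_sub_of_add_eq hadd.symm, heq]
  exact S.sub_mem hXS hYS
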